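/- **Theorem (noncommutative Poincaré lemma).** Let $k$ be a field of characteristic $0$ and let $A=\bigoplus_{p\ge 0}A_p$ be a unital associative $\mathbb N$-graded $k$-algebra which is connected, i.e. $A_0=k$. Let $b$ be the Hochschild differential $$b(a_0\otimes a_1\cdots a_p)=\sum_{0\le i<p}(-1)^i a_0\otimes\cdots\otimes a_ia_{i+1}\otimes\cdots\otimes a_p+(-1)^p a_pa_0\otimes a_1\cdots a_{p-1}$$ on $A\otimes A^{\otimes\bullet}$, and let $HH_\bullet(A)$ be the Hochschild homology of $A$ with coefficients in $A$, i.e. the homology of $(A\otimes A^{\otimes\bullet},b)$, or equivalently of the normalized complex $(A\otimes\bar A^{\otimes\bullet},b)$, $\bar A=A/k$. * Connes' operator $B(a\otimes a_1\cdots a_p)=\sum_{0\le i\le p}(-1)^{pi}\,1\otimes(a_{p-i+1}\cdots a_p\,\bar a\,a_1\cdots a_{p-i})$ on $A\otimes\bar A^{\otimes\bullet}$ induces a differential $H(B):HH_p(A)\to HH_{p+1}(A)$. Let $H_{dR}^\bullet(A)$, the de Rham cohomology of $A$, be the cohomology of $(HH_\bullet(A),H(B))$. * Let $D:A\to A$ be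 the Euler derivation, $D(a)=pa$ for $a\in A_p$. The operator $e_D(a\otimes a_1\cdots a_p)=(-1)^{p-1}(D(a_p)a)\otimes a_1\cdots a_{p-1}$ on $A\otimes A^{\otimes\bullet}$ (zero for $p=0$) induces a differential $[D]\frown-:HH_p(A)\to HH_{p-1}(A)$. Let $HH^{hi}_\bullet(A)$, the higher Hochschild homology of $A$, be the homology of $(HH_\bullet(A),[D]\frown-)$. Then there are $k$-linear isomorphisms $$H_{dR}^0(A)\cong HH^{hi}_0(A)\cong k,\qquad H_{dR}^p(A)\cong HH^{hi}_p(A)\cong 0\quad\text{for all }p>0.$$ -/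

import Mathlib

open scoped TensorProduct

noncomputable section

namespace GradedHochschild

/-! ### Homology of complexes of modules indexed by `ℕ` -/

section Homology

variable {k : Type*} [CommRing k] {M : ℕ → Type*} [∀ p, AddCommGroup (M p)] [∀ p, Module k (M p)]

/-- Cycles of the chain complex `⋯ → M 2 → M 1 → M 0 → 0`. -/
def cycles (d : ∀ p, M (p + 1) →ₗ[k] M p) : ∀ p, Submodule k (M p)
  | 0 => ⊤
  | p + 1 => LinearMap.ker (d p)

/-- Boundaries of the chain complex `⋯ → M 2 → M 1 → M 0 → 0`. -/
def boundaries (d : ∀ p, M (p + 1) →ₗ[k] M p) (p : ℕ) : Submodule k (M p) :=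
  LinearMap.range (d p)

/-- The homology `ker / im` of the chain complex `⋯ → M 2 → M 1 → M 0 → 0`. -/
abbrev Homology (d : ∀ p, M (p + 1) →ₗ[k] M p) (p : ℕ) : Type _ :=
  cycles d p ⧸ (boundaries d p).submoduleOf (cycles d p)

/-- Coboundaries of the cochain complex `0 → M 0 → M 1 → M 2 → ⋯`. -/
def coboundaries (d : ∀ p, M p →ₗ[k] M (p + 1)) : ∀ p, Submodule k (M p)
  | 0 => ⊥
  | p + 1 => LinearMap.range (d p)

/-- The cohomology `ker / im` of the cochain complex `0 → M 0 → M 1 → M 2 → ⋯`. -/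
abbrev Cohomology (d : ∀ p, M p →ₗ[k] M (p + 1)) (p : ℕ) : Type _ :=
  LinearMap.ker (d p) ⧸ (coboundaries d p).submoduleOf (LinearMap.ker (d p))

/-- The map induced on homology by a linear map preserving cycles and boundaries. -/
def homologyMap (d : ∀ p, M (p + 1) →ₗ[k] M p) {p q : ℕ} (f : M p →ₗ[k] M q)
    (hc : ∀ x ∈ cycles d p, f x ∈ cycles d q) (hb : ∀ x ∈ boundaries d p, f x ∈ boundaries d q) :
    Homology d p →ₗ[k] Homology d q :=
  Submodule.mapQ _ _ (f.restrict hc) fun x hx => hb x.1 hx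

/-- A degree `-1` map `e` with `d e = - e d` preserves cycles. -/
theorem lower_cycles {d e : ∀ p, M (p + 1) →ₗ[k] M p}
    (h : ∀ p x, d p (e (p + 1) x) = -e p (d (p + 1) x)) (p : ℕ) :
    ∀ x ∈ cycles d (p + 1), e p x ∈ cycles d p := by
  intro x hx
  cases p with
  | zero => trivial
  | succ p =>
    have hx' : d (p + 1) x = 0 := hx
    change d p (e (p + 1) x) = 0
    rw [h, hx', map_zero, neg_zero]

/-- A degree `-1` map `e` with `d e = - e d` preserves boundaries. -/
theorem lower_boundaries {d e : ∀ p, M (p + 1) →ₗ[k] M p}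
    (h : ∀ p x, d p (e (p + 1) x) = -e p (d (p + 1) x)) (p : ℕ) :
    ∀ x ∈ boundaries d (p + 1), e p x ∈ boundaries d p := by
  rintro _ ⟨y, rfl⟩
  exact ⟨-e (p + 1) y, by rw [map_neg, h, neg_neg]⟩

/-- A degree `1` map `B` with `d B = - B d` (and `d B = 0` in degree `0`) preserves cycles. -/
theorem raise_cycles {d : ∀ p, M (p + 1) →ₗ[k] M p} {B : ∀ p, M p →ₗ[k] M (p + 1)}
    (h0 : ∀ x, d 0 (B 0 x) = 0) (h : ∀ p x, d (p + 1) (B (p + 1) x) = -B p (d p x)) (p : ℕ) :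
    ∀ x ∈ cycles d p, B p x ∈ cycles d (p + 1) := by
  intro x hx
  cases p with
  | zero => exact h0 x
  | succ p =>
    have hx' : d p x = 0 := hx
    change d (p + 1) (B (p + 1) x) = 0
    rw [h, hx', map_zero, neg_zero]

/-- A degree `1` map `B` with `d B = - B d` preserves boundaries. -/
theorem raise_boundaries {d : ∀ p, M (p + 1) →ₗ[k] M p} {B : ∀ p, M p →ₗ[k] M (p + 1)}
    (h : ∀ p x, d (p + 1) (B (p + 1) x) = -B p (d p x)) (p : ℕ) :
    ∀ x ∈ boundaries d p, B p x ∈ boundaries d (p + 1) := by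
  rintro _ ⟨y, rfl⟩
  exact ⟨-B (p + 1) y, by rw [map_neg, h, neg_neg]⟩

end Homology

/-! ### Operations on tuples -/

section Tuples

variable {A : Type*}

/-- `(a₀, …, a_{p+1}) ↦ (F (a_{p+1}) a₀, a₁, …, a_p)`. -/
def wrap [Mul A] (F : A → A) {p : ℕ} (a : Fin (p + 2) → A) : Fin (p + 1) → A :=
  fun j => if j = 0 then F (a (Fin.last (p + 1))) * a 0 else a j.castSucc

/-- `(a₀, …, a_{p+1}) ↦ (a₀, …, aᵢ aᵢ₊₁, …, a_{p+1})` for `i ≤ p`, and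
`(a₀, …, a_{p+1}) ↦ (a_{p+1} a₀, a₁, …, a_p)` for `i = p + 1`. -/
def face [Mul A] {p : ℕ} (i : Fin (p + 2)) (a : Fin (p + 2) → A) : Fin (p + 1) → A :=
  if i = Fin.last (p + 1) then wrap id a else Fin.contractNth i (· * ·) a

/-- `(a₀, …, a_p) ↦ (a_{p-i+1}, …, a_p, a₀, …, a_{p-i})`; the subtraction is modulo `p + 1`. -/
def rotate {p : ℕ} (i : Fin (p + 1)) (a : Fin (p + 1) → A) : Fin (p + 1) → A :=
  fun j => a (j - i)

theorem rotate_rotate {p : ℕ} (i j : Fin (p + 1)) (a : Fin (p + 1) → A) :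
    rotate i (rotate j a) = rotate (i + j) a := by
  funext l
  simp only [rotate]
  congr 1
  abel

theorem rotate_zero {p : ℕ} (a : Fin (p + 1) → A) : rotate 0 a = a := by
  funext l
  simp [rotate]

/-- `rotate 1` for tuples given by the first values of a sequence. -/
def turnSeq (p : ℕ) (a : ℕ → A) (j : ℕ) : A :=
  if j = 0 then a p else a (j - 1)

theorem turn_seq {p : ℕ} (a : ℕ → A) :
    rotate 1 (fun j : Fin (p + 1) => a j) = fun j : Fin (p + 1) => turnSeq p a j := by
  funext j
  simp only [rotate, turnSeq]
  cases p with
  | zero =>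
    have : j = 0 := Fin.ext (by omega)
    subst this
    simp
  | succ p =>
    by_cases hj : j = 0
    · subst hj
      simp 
    · have hj' : (j : ℕ) ≠ 0 := fun h => hj (Fin.ext h)
      rw [if_neg hj', Fin.val_sub_one_of_ne_zero hj]

variable [Ring A]

/-- `wrap` for tuples given by the first values of a sequence. -/
def wrapSeq (F : A → A) (p : ℕ) (a : ℕ → A) (j : ℕ) : A :=
  if j = 0 then F (a (p + 1)) * a 0 else a j

/-- `face` for tuples given by the first values of a sequence. -/
def faceSeq (p i : ℕ) (a : ℕ → A) (j : ℕ) : A :=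
  if i = p + 1 then (if j = 0 then a (p + 1) * a 0 else a j)
  else if j < i then a j else if j = i then a j * a (j + 1) else a (j + 1)

theorem exists_seq {n : ℕ} (a : Fin n → A) : ∃ a' : ℕ → A, a = fun j : Fin n => a' j :=
  ⟨fun j => if h : j < n then a ⟨j, h⟩ else 0, by funext j; simp⟩

theorem wrap_seq (F : A → A) {p : ℕ} (a : ℕ → A) :
    wrap F (fun j : Fin (p + 2) => a j) = fun j : Fin (p + 1) => wrapSeq F p a j := by
  funext j
  by_cases hj : j = 0
  · simp [wrap, wrapSeq, hj]
  · simp [wrap, wrapSeq, hj]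

theorem face_seq {p : ℕ} (i : Fin (p + 2)) (a : ℕ → A) :
    face i (fun j : Fin (p + 2) => a j) = fun j : Fin (p + 1) => faceSeq p i a j := by
  funext j
  by_cases hi : i = Fin.last (p + 1)
  · by_cases hj : j = 0
    · simp [face, faceSeq, hi, wrap, hj]
    · simp [face, faceSeq, hi, wrap, hj]
  · have hi' : (i : ℕ) ≠ p + 1 := fun h => hi (Fin.ext h)
    simp [face, faceSeq, hi, hi', Fin.contractNth]

theorem face_face {p : ℕ} (i j : Fin (p + 2)) (h : i ≤ j) (a : Fin (p + 3) → A) :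
    face i (face j.succ a) = face j (face i.castSucc a) := by
  obtain ⟨a, rfl⟩ := exists_seq a
  simp only [face_seq]
  funext l
  obtain ⟨i, hi⟩ := i
  obtain ⟨j, hj⟩ := j
  obtain ⟨l, hl⟩ := l
  simp only [Fin.mk_le_mk, Fin.succ_mk, Fin.castSucc_mk, faceSeq] at h ⊢
  grind [mul_assoc]

theorem face_turn {p : ℕ} (i : Fin (p + 1)) (a : Fin (p + 2) → A) :
    face i.succ (rotate 1 a) = rotate 1 (face i.castSucc a) := by
  obtain ⟨a, rfl⟩ := exists_seq a
  simp only [face_seq, turn_seq]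
  funext l
  obtain ⟨i, hi⟩ := i
  obtain ⟨l, hl⟩ := l
  simp only [Fin.succ_mk, Fin.castSucc_mk, faceSeq, turnSeq]
  grind

theorem face_zero_turn {p : ℕ} (a : Fin (p + 2) → A) :
    face 0 (rotate 1 a) = face (Fin.last (p + 1)) a := by
  obtain ⟨a, rfl⟩ := exists_seq a
  simp only [face_seq, turn_seq]
  funext l
  obtain ⟨l, hl⟩ := l
  simp only [Fin.val_zero, Fin.val_last, faceSeq, turnSeq]
  grind

theorem face_wrap {p : ℕ} (F : A → A) (i : Fin (p + 1)) (a : Fin (p + 3) → A) :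
    face i.castSucc (wrap F a) = wrap F (face i.castSucc.castSucc a) := by
  obtain ⟨a, rfl⟩ := exists_seq a
  simp only [face_seq, wrap_seq]
  funext l
  obtain ⟨i, hi⟩ := i
  obtain ⟨l, hl⟩ := l
  simp only [Fin.castSucc_mk, faceSeq, wrapSeq]
  grind [mul_assoc]

theorem face_zero_cons {p : ℕ} (a : Fin (p + 2) → A) :
    face 0 (Fin.cons 1 a : Fin (p + 3) → A) = a := by
  funext l
  have h : (0 : Fin (p + 3)) ≠ Fin.last (p + 2) := by simp [Fin.ext_iff]
  rcases Fin.eq_zero_or_eq_succ l with rfl | ⟨l, rfl⟩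
  · simp [face, h, Fin.contractNth]
  · simp [face, h, Fin.contractNth]

theorem face_succ_cons {p : ℕ} (i : Fin (p + 1)) (a : Fin (p + 2) → A) :
    face i.castSucc.succ (Fin.cons 1 a : Fin (p + 3) → A) =
      (Fin.cons 1 (face i.castSucc a) : Fin (p + 2) → A) := by
  funext l
  have h : i.castSucc.succ ≠ Fin.last (p + 2) := by
    have := i.2
    simp only [ne_eq, Fin.ext_iff, Fin.val_succ, Fin.val_castSucc, Fin.val_last]
    omega
  have h' : i.castSucc ≠ Fin.last (p + 1) := (Fin.castSucc_lt_last i).ne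
  simp only [face, h, h', if_false]
  rcases Fin.eq_zero_or_eq_succ l with rfl | ⟨l, rfl⟩
  · simp [Fin.contractNth]
  · simp [Fin.contractNth]

theorem face_last_cons {p : ℕ} (a : Fin (p + 2) → A) :
    face (Fin.last (p + 2)) (Fin.cons 1 a : Fin (p + 3) → A) = rotate 1 a := by
  funext l
  rcases Fin.eq_zero_or_eq_succ l with rfl | ⟨l, rfl⟩
  · simp [face, wrap, rotate, -Fin.succ_last]
    congr 1
    exact Fin.ext (by simp)
  · simp [face, wrap, rotate]
    congr 1
    exact Fin.ext (by rw [Fin.val_sub_one_of_ne_zero (Fin.succ_ne_zero l)]; simp)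

end Tuples

/-! ### Maps between tensor powers -/

section Tensor

variable (k : Type*) [CommRing k] {A : Type*} [Ring A] [Algebra k A]

/-- The linear map `⨂ⁿ A → ⨂ᵐ A`, `a₁ ⊗ ⋯ ⊗ aₙ ↦ f (a₁, …, aₙ)` (as a pure tensor), where
changing one of the `aᵢ` changes one entry of `f (a₁, …, aₙ)`, in a linear way. -/
def tensorMap {n m : ℕ} (f : (Fin n → A) → Fin m → A)
    (hf : ∀ (a : Fin n → A) (i : Fin n), ∃ (j : Fin m) (L : A →ₗ[k] A), ∀ v,
      f (Function.update a i v) = Function.update (f a) j (L v)) :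
    (⨂[k] _ : Fin n, A) →ₗ[k] ⨂[k] _ : Fin m, A :=
  PiTensorProduct.lift
    { toFun := fun a => PiTensorProduct.tprod k (f a)
      map_update_add' := by
        intro inst a i x y
        obtain rfl : inst = instDecidableEqFin n := Subsingleton.elim _ _
        obtain ⟨j, L, h⟩ := hf a i
        simp only [h, map_add, MultilinearMap.map_update_add]
      map_update_smul' := by
        intro inst a i c x
        obtain rfl : inst = instDecidableEqFin n := Subsingleton.elim _ _
        obtain ⟨j, L, h⟩ := hf a i
        simp only [h, map_smul, MultilinearMap.map_update_smul] }

@[simp] theorem tensorMap_tprod {n m : ℕ} (f : (Fin n → A) → Fin m → A) (hf)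
    (a : Fin n → A) :
    tensorMap k f hf (PiTensorProduct.tprod k a) = PiTensorProduct.tprod k (f a) := by
  simp [tensorMap]

theorem wrap_update (F : A →ₗ[k] A) {p : ℕ} (a : Fin (p + 2) → A) (m : Fin (p + 2)) :
    ∃ (j : Fin (p + 1)) (L : A →ₗ[k] A), ∀ v,
      wrap F (Function.update a m v) = Function.update (wrap F a) j (L v) := by
  by_cases hm : m = Fin.last (p + 1)
  · refine ⟨0, LinearMap.mulRight k (a 0) ∘ₗ F, fun v => ?_⟩
    funext j
    simp only [wrap, Function.update_apply, LinearMap.comp_apply, LinearMap.mulRight_apply]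
    grind [Fin.ext_iff]
  · by_cases h0 : m = 0
    · refine ⟨0, LinearMap.mulLeft k (F (a (Fin.last _))), fun v => ?_⟩
      funext j
      simp only [wrap, Function.update_apply, LinearMap.mulLeft_apply]
      grind [Fin.ext_iff]
    · refine ⟨⟨m, by grind [Fin.ext_iff]⟩, LinearMap.id, fun v => ?_⟩
      funext j
      simp only [wrap, Function.update_apply, LinearMap.id_apply]
      grind [Fin.ext_iff]

theorem contract_update {p : ℕ} (i : Fin (p + 1)) (a : Fin (p + 2) → A) (m : Fin (p + 2)) :
    ∃ (j : Fin (p + 1)) (L : A →ₗ[k] A), ∀ v,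
      Fin.contractNth i.castSucc (· * ·) (Function.update a m v) =
        Function.update (Fin.contractNth i.castSucc (· * ·) a) j (L v) := by
  rcases lt_trichotomy (m : ℕ) i with h | h | h
  · refine ⟨⟨m, by omega⟩, LinearMap.id, fun v => ?_⟩
    funext j
    simp only [Fin.contractNth, Function.update_apply, LinearMap.id_apply]
    grind [Fin.ext_iff]
  · refine ⟨i, LinearMap.mulRight k (a i.succ), fun v => ?_⟩
    funext j
    simp only [Fin.contractNth, Function.update_apply, LinearMap.mulRight_apply]
    grind [Fin.ext_iff]
  · by_cases h' : (m : ℕ) = i + 1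
    · refine ⟨i, LinearMap.mulLeft k (a i.castSucc), fun v => ?_⟩
      funext j
      simp only [Fin.contractNth, Function.update_apply, LinearMap.mulLeft_apply]
      grind [Fin.ext_iff]
    · refine ⟨⟨m - 1, by omega⟩, LinearMap.id, fun v => ?_⟩
      funext j
      simp only [Fin.contractNth, Function.update_apply, LinearMap.id_apply]
      grind [Fin.ext_iff]

theorem face_update {p : ℕ} (i : Fin (p + 2)) (a : Fin (p + 2) → A) (m : Fin (p + 2)) :
    ∃ (j : Fin (p + 1)) (L : A →ₗ[k] A), ∀ v,
      face i (Function.update a m v) = Function.update (face i a) j (L v) := by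
  by_cases hi : i = Fin.last (p + 1)
  · simpa only [face, hi, if_true, LinearMap.id_coe] using wrap_update k LinearMap.id a m
  · simpa only [face, hi, if_false, Fin.castSucc_castPred] using
      contract_update k (i.castPred hi) a m

theorem cons_rotate_update {p : ℕ} (i : Fin (p + 1)) (a : Fin (p + 1) → A) (m : Fin (p + 1)) :
    ∃ (j : Fin (p + 2)) (L : A →ₗ[k] A), ∀ v,
      (Fin.cons 1 (rotate i (Function.update a m v)) : Fin (p + 2) → A) =
        Function.update (Fin.cons 1 (rotate i a) : Fin (p + 2) → A) j (L v) := by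
  refine ⟨(m + i).succ, LinearMap.id, fun v => ?_⟩
  rw [← Fin.cons_update]
  congr 1
  funext j
  simp [rotate, Function.update_apply, sub_eq_iff_eq_add]

end Tensor

/-! ### The Hochschild complex -/

section Hochschild

variable (k : Type*) [CommRing k] (A : Type*) [Ring A] [Algebra k A]

/-- Hochschild `p`-chains `A ⊗ A^{⊗ p}`, as the tensor power `A^{⊗ (p + 1)}`. -/
abbrev Chains (p : ℕ) : Type _ := ⨂[k] _ : Fin (p + 1), A

/-- The Hochschild differential, `b (a₀ ⊗ ⋯ ⊗ a_{p+1}) =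
∑_{i ≤ p} (-1)^i a₀ ⊗ ⋯ ⊗ aᵢ aᵢ₊₁ ⊗ ⋯ ⊗ a_{p+1} + (-1)^{p+1} a_{p+1} a₀ ⊗ a₁ ⊗ ⋯ ⊗ a_p`. -/
def hochschildB (p : ℕ) : Chains k A (p + 1) →ₗ[k] Chains k A p :=
  ∑ i : Fin (p + 2), (-1 : k) ^ (i : ℕ) • tensorMap k (face i) (face_update k i)

variable {A} in
/-- The cap product `F ⌢ -` with a `1`-cochain `F : A → A`,
`F ⌢ (a₀ ⊗ a₁ ⊗ ⋯ ⊗ a_{p+1}) = (-1)^p F (a_{p+1}) a₀ ⊗ a₁ ⊗ ⋯ ⊗ a_p`. -/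
def cap (F : A →ₗ[k] A) (p : ℕ) : Chains k A (p + 1) →ₗ[k] Chains k A p :=
  (-1 : k) ^ p • tensorMap k (wrap F) (wrap_update k F)

/-- `a₀ ⊗ ⋯ ⊗ a_p ↦
∑_{i ≤ p} (-1)^{p i} 1 ⊗ a_{p-i+1} ⊗ ⋯ ⊗ a_p ⊗ a₀ ⊗ a₁ ⊗ ⋯ ⊗ a_{p-i}`. -/
def connesB (p : ℕ) : Chains k A p →ₗ[k] Chains k A (p + 1) :=
  ∑ i : Fin (p + 1), (-1 : k) ^ (p * i) •
    tensorMap k (fun a => (Fin.cons 1 (rotate i a) : Fin (p + 2) → A)) (cons_rotate_update k i)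

/-- The submodule spanned by the `a₀ ⊗ a₁ ⊗ ⋯ ⊗ a_p` with `aᵢ = 1` for some `i ≥ 1`. -/
def degenerate (p : ℕ) : Submodule k (Chains k A p) :=
  Submodule.span k
    {x | ∃ (a : Fin (p + 1) → A) (i : Fin (p + 1)), i ≠ 0 ∧ a i = 1 ∧ x = PiTensorProduct.tprod k a}

theorem hochschildB_tprod (p : ℕ) (a : Fin (p + 2) → A) :
    hochschildB k A p (PiTensorProduct.tprod k a) =
      ∑ i : Fin (p + 2), (-1 : k) ^ (i : ℕ) • PiTensorProduct.tprod k (face i a) := by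
  simp [hochschildB]

theorem cap_tprod (F : A →ₗ[k] A) (p : ℕ) (a : Fin (p + 2) → A) :
    cap k F p (PiTensorProduct.tprod k a) = (-1 : k) ^ p • PiTensorProduct.tprod k (wrap F a) := by
  simp [cap]

theorem connesB_tprod (p : ℕ) (a : Fin (p + 1) → A) :
    connesB k A p (PiTensorProduct.tprod k a) =
      ∑ i : Fin (p + 1), (-1 : k) ^ (p * i) •
        PiTensorProduct.tprod k (Fin.cons 1 (rotate i a) : Fin (p + 2) → A) := by
  simp [connesB]

variable {k A} in
/-- Linear maps agreeing on pure tensors are equal. -/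
theorem eq_of_tprod {n : ℕ} {N : Type*} [AddCommGroup N] [Module k N]
    {f g : (⨂[k] _ : Fin n, A) →ₗ[k] N}
    (h : ∀ a, f (PiTensorProduct.tprod k a) = g (PiTensorProduct.tprod k a)) (x) : f x = g x := by
  have : f = g := PiTensorProduct.ext (MultilinearMap.ext h)
  rw [this]

/-- `b² = 0`. -/
theorem hochschildB_hochschildB (p : ℕ) (x : Chains k A (p + 2)) :
    hochschildB k A p (hochschildB k A (p + 1) x) = 0 := by
  refine eq_of_tprod (f := hochschildB k A p ∘ₗ hochschildB k A (p + 1)) (g := 0) (fun a => ?_) x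
  simp only [LinearMap.comp_apply, LinearMap.zero_apply, hochschildB_tprod, map_sum, map_smul,
    Finset.smul_sum, smul_smul]
  rw [← Finset.sum_product', Finset.univ_product_univ]
  let S : Finset (Fin (p + 3) × Fin (p + 2)) := {ij | (ij.1 : ℕ) ≤ (ij.2 : ℕ)}
  rw [← Finset.sum_add_sum_compl S, ← eq_neg_iff_add_eq_zero, ← Finset.sum_neg_distrib]
  refine Finset.sum_bij
    (fun ij hij => (ij.2.succ, ij.1.castLT (lt_of_le_of_lt (Finset.mem_filter.mp hij).2 ij.2.2)))
    ?_ ?_ ?_ ?_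
  · rintro ⟨i, j⟩ hij
    simp only [S, Finset.mem_filter_univ, Finset.mem_compl] at hij ⊢
    simp only [Fin.val_succ, Fin.val_castLT]
    omega
  · rintro ⟨i, j⟩ hij ⟨i', j'⟩ hij' h
    simp only [Prod.mk.injEq, Fin.ext_iff, Fin.val_succ, Fin.val_castLT] at h ⊢
    omega
  · rintro ⟨i, j⟩ hij
    simp only [S, Finset.mem_filter_univ, Finset.mem_compl, not_le] at hij
    refine ⟨(j.castSucc, i.pred (by rintro rfl; simp at hij)), ?_, ?_⟩
    · simp only [S, Finset.mem_filter_univ, Fin.val_castSucc, Fin.val_pred]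
      omega
    · simp
  · rintro ⟨i, j⟩ hij
    simp only [S, Finset.mem_filter_univ] at hij
    have hi : i = (i.castLT (lt_of_le_of_lt hij j.2)).castSucc := rfl
    have := face_face (i.castLT (lt_of_le_of_lt hij j.2)) j hij a
    rw [← hi] at this
    rw [this, ← neg_smul]
    congr 1
    simp only [Fin.val_succ, Fin.val_castLT]
    ring

theorem last_face_wrap {A : Type*} [Ring A] {p : ℕ} (F : A → A) (a : Fin (p + 3) → A) :
    face (Fin.last (p + 1)) (wrap F a) =
      Function.update (fun j : Fin (p + 1) => a j.castSucc.castSucc) 0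
        (a (Fin.last (p + 1)).castSucc * F (a (Fin.last (p + 2))) * a 0) := by
  funext l
  by_cases hl : l = 0
  · subst hl
    simp [face, wrap, mul_assoc]
  · simp [face, wrap, hl]

theorem wrap_last_face {A : Type*} [Ring A] {p : ℕ} (F : A → A) (a : Fin (p + 3) → A) :
    wrap F (face (Fin.last (p + 2)) a) =
      Function.update (fun j : Fin (p + 1) => a j.castSucc.castSucc) 0
        (F (a (Fin.last (p + 1)).castSucc) * a (Fin.last (p + 2)) * a 0) := by
  funext l
  by_cases hl : l = 0
  · subst hl
    simp [face, wrap, mul_assoc]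
  · simp [face, wrap, hl]

theorem wrap_pred_last_face {A : Type*} [Ring A] {p : ℕ} (F : A → A) (a : Fin (p + 3) → A) :
    wrap F (face (Fin.last (p + 1)).castSucc a) =
      Function.update (fun j : Fin (p + 1) => a j.castSucc.castSucc) 0
        (F (a (Fin.last (p + 1)).castSucc * a (Fin.last (p + 2))) * a 0) := by
  funext l
  have h : (Fin.last (p + 1)).castSucc ≠ Fin.last (p + 2) := (Fin.castSucc_lt_last _).ne
  by_cases hl : l = 0
  · subst hl
    simp [face, wrap, Fin.contractNth, h]
  · have h1 : (l : ℕ) < p + 1 := l.2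
    simp [face, wrap, hl, Fin.contractNth, h, h1]

theorem wrap_wrap {A : Type*} [Ring A] {p : ℕ} (F G : A → A) (a : Fin (p + 3) → A) :
    wrap F (wrap G a) =
      Function.update (fun j : Fin (p + 1) => a j.castSucc.castSucc) 0
        (F (a (Fin.last (p + 1)).castSucc) * G (a (Fin.last (p + 2))) * a 0) := by
  funext l
  by_cases hl : l = 0
  · subst hl
    simp [wrap, mul_assoc]
  · simp [wrap, hl]

/-- `b (F ⌢ x) + F ⌢ b x` is, up to sign, the cap product with the coboundary of `F`. -/
theorem hochschildB_cap_add (F : A →ₗ[k] A) (p : ℕ) (a : Fin (p + 3) → A) :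
    hochschildB k A p (cap k F (p + 1) (PiTensorProduct.tprod k a)) +
      cap k F p (hochschildB k A (p + 1) (PiTensorProduct.tprod k a)) =
    PiTensorProduct.tprod k
      (Function.update (fun j : Fin (p + 1) => a j.castSucc.castSucc) 0
        ((a (Fin.last (p + 1)).castSucc * F (a (Fin.last (p + 2))) +
          F (a (Fin.last (p + 1)).castSucc) * a (Fin.last (p + 2)) -
          F (a (Fin.last (p + 1)).castSucc * a (Fin.last (p + 2)))) * a 0)) := by
  have h1 : ((-1 : k) ^ p) * (-1) ^ p = 1 := by rw [← mul_pow]; simp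
  simp only [cap_tprod, hochschildB_tprod, map_smul, map_sum, sub_mul, add_mul,
    MultilinearMap.map_update_sub, MultilinearMap.map_update_add]
  rw [Fin.sum_univ_castSucc, Fin.sum_univ_castSucc (n := p + 2),
    Fin.sum_univ_castSucc (n := p + 1)]
  simp only [face_wrap, last_face_wrap, wrap_last_face, wrap_pred_last_face, smul_add,
    Finset.smul_sum, smul_smul, Fin.val_castSucc, Fin.val_last, pow_succ]
  simp only [neg_smul, Finset.sum_neg_distrib, mul_neg, neg_mul, mul_one, one_smul, h1, neg_neg]
  simp only [mul_comm ((-1 : k) ^ p)]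
  abel

variable {k A} in
/-- `b (F ⌢ x) = -(F ⌢ b x)` if `F` is a derivation. -/
theorem hochschildB_cap {F : A →ₗ[k] A} (hF : ∀ a b, F (a * b) = a * F b + F a * b) (p : ℕ)
    (x : Chains k A (p + 2)) :
    hochschildB k A p (cap k F (p + 1) x) = -cap k F p (hochschildB k A (p + 1) x) := by
  rw [eq_neg_iff_add_eq_zero]
  refine eq_of_tprod (f := hochschildB k A p ∘ₗ cap k F (p + 1) + cap k F p ∘ₗ hochschildB k A (p + 1))
    (g := 0) (fun a => ?_) x
  simp only [LinearMap.add_apply, LinearMap.comp_apply, hochschildB_cap_add, hF, sub_self, zero_mul,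
    LinearMap.zero_apply]
  exact (PiTensorProduct.tprod k).map_update_zero _ _

variable {k A} in
/-- `2 F ⌢ (F ⌢ x) = b (F² ⌢ x) + F² ⌢ b x` if `F` is a derivation. -/
theorem two_smul_cap_cap {F : A →ₗ[k] A} (hF : ∀ a b, F (a * b) = a * F b + F a * b) (p : ℕ)
    (x : Chains k A (p + 2)) :
    (2 : k) • cap k F p (cap k F (p + 1) x) =
      hochschildB k A p (cap k (F ∘ₗ F) (p + 1) x) +
        cap k (F ∘ₗ F) p (hochschildB k A (p + 1) x) := by
  refine eq_of_tprod (f := (2 : k) • (cap k F p ∘ₗ cap k F (p + 1)))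
    (g := hochschildB k A p ∘ₗ cap k (F ∘ₗ F) (p + 1) +
      cap k (F ∘ₗ F) p ∘ₗ hochschildB k A (p + 1)) (fun a => ?_) x
  have h1 : ((-1 : k) ^ (p + 1)) * (-1) ^ p = -1 := by rw [pow_succ, mul_neg_one, neg_mul, ← mul_pow]; simp
  simp only [LinearMap.add_apply, LinearMap.comp_apply, LinearMap.smul_apply]
  rw [hochschildB_cap_add]
  simp only [LinearMap.comp_apply, cap_tprod, map_smul, wrap_wrap, smul_smul, mul_assoc, h1]
  rw [← MultilinearMap.map_update_smul]
  congr 2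
  simp only [hF, map_add]
  simp only [mul_neg, mul_one, neg_smul, two_smul]
  noncomm_ring

/-! ### Connes' operator -/

variable {A} in
/-- Signed cyclic rotation. -/
def turn (p : ℕ) : Module.End k (Chains k A p) :=
  (-1 : k) ^ p • tensorMap k (rotate 1) fun a m => by
    refine ⟨m + 1, LinearMap.id, fun v => ?_⟩
    funext j
    simp [rotate, Function.update_apply, sub_eq_iff_eq_add]

variable {A} in
/-- The norm of the signed cyclic rotation. -/
def norm (p : ℕ) : Module.End k (Chains k A p) := ∑ i ∈ Finset.range (p + 1), turn k p ^ i

theorem turn_pow_tprod (p n : ℕ) (a : Fin (p + 1) → A) :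
    (turn k p ^ n) (PiTensorProduct.tprod k a) =
      (-1 : k) ^ (p * n) • PiTensorProduct.tprod k (rotate (Fin.ofNat (p + 1) n) a) := by
  induction n with
  | zero => simp [rotate_zero]
  | succ n ih =>
    rw [pow_succ', Module.End.mul_apply, ih, map_smul, turn, LinearMap.smul_apply, tensorMap_tprod,
      rotate_rotate, smul_smul, mul_add, pow_add, mul_one]
    congr 4
    exact Fin.ext (by simp [Fin.val_add, add_comm])

theorem turn_pow_card (p : ℕ) : turn k p ^ (p + 1) = (1 : Module.End k (Chains k A p)) := by
  refine LinearMap.ext fun x => eq_of_tprod (fun a => ?_) x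
  rw [turn_pow_tprod, Module.End.one_apply, (Nat.even_mul_succ_self p).neg_one_pow, one_smul]
  have h : Fin.ofNat (p + 1) (p + 1) = 0 := Fin.ext (by simp)
  rw [h, rotate_zero]

theorem turn_mul_norm (p : ℕ) : turn k p * norm k p = (norm k p : Module.End k (Chains k A p)) := by
  have h : (turn k p - 1) * norm k p = (0 : Module.End k (Chains k A p)) := by
    rw [norm, mul_geom_sum, turn_pow_card, sub_self]
  rwa [sub_mul, one_mul, sub_eq_zero] at h

theorem norm_mul_turn (p : ℕ) : norm k p * turn k p = (norm k p : Module.End k (Chains k A p)) := by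
  have h : norm k p * (turn k p - 1) = (0 : Module.End k (Chains k A p)) := by
    rw [norm, geom_sum_mul, turn_pow_card, sub_self]
  rwa [mul_sub, mul_one, sub_eq_zero] at h

theorem turn_pow_norm (p n : ℕ) (x : Chains k A p) : (turn k p ^ n) (norm k p x) = norm k p x := by
  induction n with
  | zero => rfl
  | succ n ih =>
    have h := LinearMap.congr_fun (turn_mul_norm k A p) x
    rw [Module.End.mul_apply] at h
    rw [pow_succ, Module.End.mul_apply, h, ih]

theorem norm_turn_pow (p n : ℕ) (x : Chains k A p) : norm k p ((turn k p ^ n) x) = norm k p x := by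
  induction n generalizing x with
  | zero => rfl
  | succ n ih =>
    have h := LinearMap.congr_fun (norm_mul_turn k A p) x
    rw [Module.End.mul_apply] at h
    rw [pow_succ, Module.End.mul_apply, ih, h]

variable {A} in
/-- The `i`-th face with its sign. -/
def signedFace {p : ℕ} (i : Fin (p + 2)) : Chains k A (p + 1) →ₗ[k] Chains k A p :=
  (-1 : k) ^ (i : ℕ) • tensorMap k (face i) (face_update k i)

variable {A} in
/-- Insertion of `1` in front. -/
def consOne (p : ℕ) : Chains k A p →ₗ[k] Chains k A (p + 1) :=
  tensorMap k (fun a => (Fin.cons 1 a : Fin (p + 2) → A)) fun a m =>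
    ⟨m.succ, LinearMap.id, fun v => by rw [← Fin.cons_update]; rfl⟩

theorem hochschildB_eq_sum (p : ℕ) : hochschildB k A p = ∑ i, signedFace k i := rfl

theorem connesB_eq (p : ℕ) (x : Chains k A p) : connesB k A p x = consOne k p (norm k p x) := by
  refine eq_of_tprod (g := consOne k p ∘ₗ norm k p) (fun a => ?_) x
  rw [connesB_tprod, LinearMap.comp_apply, norm, LinearMap.sum_apply, Finset.sum_range, map_sum]
  refine Finset.sum_congr rfl fun i _ => ?_
  rw [turn_pow_tprod, map_smul, consOne, tensorMap_tprod]
  congr 4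
  exact Fin.ext (by simp)

theorem signedFace_turn_pow {p : ℕ} (n : ℕ) (h : n < p + 2) (x : Chains k A (p + 1)) :
    signedFace k ⟨n, h⟩ ((turn k (p + 1) ^ n) x) = (turn k p ^ n) (signedFace k 0 x) := by
  induction n with
  | zero => rfl
  | succ n ih =>
    have key : ∀ y : Chains k A (p + 1), signedFace k ⟨n + 1, h⟩ (turn k (p + 1) y) =
        turn k p (signedFace k ⟨n, by omega⟩ y) := by
      intro y
      refine eq_of_tprod (f := signedFace k ⟨n + 1, h⟩ ∘ₗ turn k (p + 1))
        (g := turn k p ∘ₗ signedFace k ⟨n, by omega⟩) (fun a => ?_) y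
      have := face_turn ⟨n, by omega⟩ a
      simp only [Fin.succ_mk, Fin.castSucc_mk] at this
      simp only [LinearMap.comp_apply, signedFace, turn, LinearMap.smul_apply, tensorMap_tprod,
        map_smul, smul_smul, this]
      congr 1
      ring
    rw [pow_succ', Module.End.mul_apply, key, ih (by omega), pow_succ', Module.End.mul_apply]

theorem norm_hochschildB (p : ℕ) (x : Chains k A (p + 1)) :
    norm k p (hochschildB k A p x) = norm k p (signedFace k 0 (norm k (p + 1) x)) := by
  have h : ∀ i : Fin (p + 2), norm k p (signedFace k i x) =
      norm k p (signedFace k 0 ((turn k (p + 1) ^ (p + 2 - (i : ℕ))) x)) := by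
    intro i
    have h1 : x = (turn k (p + 1) ^ (i : ℕ)) ((turn k (p + 1) ^ (p + 2 - (i : ℕ))) x) := by
      rw [← Module.End.mul_apply, ← pow_add, Nat.add_sub_cancel' i.2.le, turn_pow_card,
        Module.End.one_apply]
    conv_lhs => rw [h1, signedFace_turn_pow k A i i.2, norm_turn_pow]
  have h2 : norm k (p + 1) x = ∑ i : Fin (p + 2), (turn k (p + 1) ^ (p + 2 - (i : ℕ))) x := by
    rw [← turn_mul_norm, norm, Finset.mul_sum, LinearMap.sum_apply, ← Finset.sum_range_reflect,
      Finset.sum_range]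
    refine Finset.sum_congr rfl fun i _ => ?_
    rw [← pow_succ']
    congr 2
    have := i.2
    omega
  rw [hochschildB_eq_sum, LinearMap.sum_apply, map_sum, h2, map_sum, map_sum]
  exact Finset.sum_congr rfl fun i _ => h i

theorem sum_signedFace_norm (p : ℕ) (x : Chains k A (p + 1)) :
    ∑ i : Fin (p + 1), signedFace k i.castSucc (norm k (p + 1) x) =
      norm k p (signedFace k 0 (norm k (p + 1) x)) := by
  conv_rhs => rw [norm, LinearMap.sum_apply, Finset.sum_range]
  refine Finset.sum_congr rfl fun i _ => ?_
  rw [← signedFace_turn_pow k A i (by omega), turn_pow_norm]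
  rfl

theorem hochschildB_consOne (p : ℕ) (x : Chains k A (p + 1)) :
    hochschildB k A (p + 1) (consOne k (p + 1) x) =
      x - consOne k p (∑ i : Fin (p + 1), signedFace k i.castSucc x) - turn k (p + 1) x := by
  refine eq_of_tprod (f := hochschildB k A (p + 1) ∘ₗ consOne k (p + 1))
    (g := LinearMap.id - consOne k p ∘ₗ (∑ i : Fin (p + 1), signedFace k i.castSucc) -
      turn k (p + 1)) (fun a => ?_) x |>.trans ?_
  · simp only [LinearMap.comp_apply, LinearMap.sub_apply, LinearMap.sum_apply, LinearMap.id_apply,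
      consOne, tensorMap_tprod, hochschildB_tprod, signedFace, turn, LinearMap.smul_apply, map_sum,
      map_smul]
    rw [Fin.sum_univ_succ, Fin.sum_univ_castSucc]
    simp only [face_zero_cons, face_succ_cons, Fin.succ_last, face_last_cons, Fin.val_zero, pow_zero,
      one_smul, Fin.val_succ, Fin.val_castSucc, Fin.val_last, pow_succ, mul_neg, mul_one, neg_smul,
      Finset.sum_neg_distrib, neg_neg]
    abel
  · simp

/-- `b B = -B b`. -/
theorem hochschildB_connesB (p : ℕ) (x : Chains k A (p + 1)) :
    hochschildB k A (p + 1) (connesB k A (p + 1) x) = -connesB k A p (hochschildB k A p x) := by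
  rw [connesB_eq, connesB_eq, hochschildB_consOne, sum_signedFace_norm, norm_hochschildB,
    ← Module.End.mul_apply (turn k (p + 1)), turn_mul_norm]
  abel

/-- `b B = 0` on `0`-chains. -/
theorem hochschildB_connesB_zero (x : Chains k A 0) :
    hochschildB k A 0 (connesB k A 0 x) = 0 := by
  refine eq_of_tprod (f := hochschildB k A 0 ∘ₗ connesB k A 0) (g := 0) (fun a => ?_) x
  have h : face 0 (Fin.cons 1 (rotate 0 a) : Fin 2 → A) =
      face 1 (Fin.cons 1 (rotate 0 a) : Fin 2 → A) := by
    funext j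
    obtain rfl : j = 0 := Fin.ext (by omega)
    simp [face, wrap, Fin.contractNth]
  simp [connesB_tprod, hochschildB_tprod, Fin.sum_univ_succ, h]

/-! ### The normalized Hochschild complex -/

/-- Normalized chains `A ⊗ (A / k)^{⊗ p}`: the quotient of `A ⊗ A^{⊗ p}` by the
`a₀ ⊗ a₁ ⊗ ⋯ ⊗ a_p` with `aᵢ = 1` for some `i ≥ 1`. -/
abbrev NormalizedChains (p : ℕ) : Type _ := Chains k A p ⧸ degenerate k A p

theorem tprod_mem_degenerate {p : ℕ} (a : Fin (p + 1) → A) (i : Fin (p + 1)) (hi : i ≠ 0)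
    (h : a i = 1) : PiTensorProduct.tprod k a ∈ degenerate k A p :=
  Submodule.subset_span ⟨a, i, hi, h, rfl⟩

theorem degenerate_le_comap_hochschildB (p : ℕ) :
    degenerate k A (p + 1) ≤ (degenerate k A p).comap (hochschildB k A p) := by
  refine Submodule.span_le.2 ?_
  rintro _ ⟨a, m, hm, ha, rfl⟩
  obtain ⟨m, rfl⟩ := Fin.exists_succ_eq.2 hm
  rw [SetLike.mem_coe, Submodule.mem_comap, hochschildB_tprod]
  have heq : face m.castSucc a = face m.succ a := by
    obtain ⟨a, rfl⟩ := exists_seq a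
    simp only [face_seq]
    funext l
    obtain ⟨m, hm⟩ := m
    obtain ⟨l, hl⟩ := l
    simp only [Fin.succ_mk, Fin.castSucc_mk, faceSeq] at ha ⊢
    grind
  have hne : m.castSucc ≠ m.succ := (Fin.castSucc_lt_succ).ne
  rw [← Finset.add_sum_erase _ _ (Finset.mem_univ m.castSucc),
    ← Finset.add_sum_erase _ _ (Finset.mem_erase.2 ⟨hne.symm, Finset.mem_univ m.succ⟩), ← add_assoc]
  refine Submodule.add_mem _ ?_ (Submodule.sum_mem _ fun i hi => Submodule.smul_mem _ _ ?_)
  · rw [heq, ← add_smul, Fin.val_castSucc, Fin.val_succ, pow_succ, mul_neg_one, add_neg_cancel,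
      zero_smul]
    exact Submodule.zero_mem _
  · simp only [Finset.mem_erase, Finset.mem_univ, and_true] at hi
    obtain ⟨hi1, hi2⟩ := hi
    obtain ⟨j, hj0, hj⟩ : ∃ j : Fin (p + 1), j ≠ 0 ∧ face i a j = 1 := by
      obtain ⟨a, rfl⟩ := exists_seq a
      simp only [face_seq]
      obtain ⟨m, hm'⟩ := m
      obtain ⟨i, hi⟩ := i
      simp only [Fin.succ_mk, Fin.castSucc_mk, Fin.mk.injEq, ne_eq, faceSeq] at ha hi1 hi2 ⊢
      rcases lt_or_ge i m with h | h
      · refine ⟨⟨m, hm'⟩, by simp [Fin.ext_iff]; omega, ?_⟩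
        grind
      · refine ⟨⟨m + 1, by omega⟩, by simp [Fin.ext_iff], ?_⟩
        grind
    exact tprod_mem_degenerate k A _ j hj0 hj

theorem degenerate_le_comap_connesB (p : ℕ) :
    degenerate k A p ≤ (degenerate k A (p + 1)).comap (connesB k A p) := by
  refine Submodule.span_le.2 ?_
  rintro _ ⟨a, m, _, ha, rfl⟩
  rw [SetLike.mem_coe, Submodule.mem_comap, connesB_tprod]
  refine Submodule.sum_mem _ fun i _ => Submodule.smul_mem _ _ ?_
  exact tprod_mem_degenerate k A _ (m + i).succ (Fin.succ_ne_zero _) (by simp [rotate, ha])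

/-- The differential of the normalized Hochschild complex. -/
def normalizedB (p : ℕ) : NormalizedChains k A (p + 1) →ₗ[k] NormalizedChains k A p :=
  Submodule.mapQ _ _ (hochschildB k A p) (degenerate_le_comap_hochschildB k A p)

/-- Connes' operator `B` on normalized chains. -/
def normalizedConnesB (p : ℕ) : NormalizedChains k A p →ₗ[k] NormalizedChains k A (p + 1) :=
  Submodule.mapQ _ _ (connesB k A p) (degenerate_le_comap_connesB k A p)

/-- `b² = 0` on normalized chains. -/
theorem normalizedB_normalizedB (p : ℕ) (x : NormalizedChains k A (p + 2)) :
    normalizedB k A p (normalizedB k A (p + 1) x) = 0 := by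
  obtain ⟨x, rfl⟩ := Submodule.Quotient.mk_surjective _ x
  simp only [normalizedB, Submodule.mapQ_apply, hochschildB_hochschildB, Submodule.Quotient.mk_zero]

theorem normalizedB_normalizedConnesB (p : ℕ) (x : NormalizedChains k A (p + 1)) :
    normalizedB k A (p + 1) (normalizedConnesB k A (p + 1) x) =
      -normalizedConnesB k A p (normalizedB k A p x) := by
  obtain ⟨x, rfl⟩ := Submodule.Quotient.mk_surjective _ x
  simp only [normalizedB, normalizedConnesB, Submodule.mapQ_apply, hochschildB_connesB,
    Submodule.Quotient.mk_neg]

theorem normalizedB_normalizedConnesB_zero (x : NormalizedChains k A 0) :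
    normalizedB k A 0 (normalizedConnesB k A 0 x) = 0 := by
  obtain ⟨x, rfl⟩ := Submodule.Quotient.mk_surjective _ x
  simp only [normalizedB, normalizedConnesB, Submodule.mapQ_apply, hochschildB_connesB_zero,
    Submodule.Quotient.mk_zero]

theorem connesB_connesB_mem (p : ℕ) (x : Chains k A p) :
    connesB k A (p + 1) (connesB k A p x) ∈ degenerate k A (p + 2) := by
  have hx : x ∈ Submodule.span k (Set.range (PiTensorProduct.tprod k)) := by
    rw [PiTensorProduct.span_tprod_eq_top]; trivial
  induction hx using Submodule.span_induction with
  | mem x hx =>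
    obtain ⟨a, rfl⟩ := hx
    rw [connesB_tprod, map_sum]
    refine Submodule.sum_mem _ fun i _ => ?_
    rw [map_smul, connesB_tprod]
    refine Submodule.smul_mem _ _ (Submodule.sum_mem _ fun j _ => Submodule.smul_mem _ _ ?_)
    exact tprod_mem_degenerate k A _ j.succ (Fin.succ_ne_zero _) (by simp [rotate])
  | zero => simp
  | add x y _ _ hx hy => rw [map_add, map_add]; exact Submodule.add_mem _ hx hy
  | smul c x _ hx => rw [map_smul, map_smul]; exact Submodule.smul_mem _ _ hx

/-- `B² = 0` on normalized chains. -/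
theorem normalizedConnesB_normalizedConnesB (p : ℕ) (x : NormalizedChains k A p) :
    normalizedConnesB k A (p + 1) (normalizedConnesB k A p x) = 0 := by
  obtain ⟨x, rfl⟩ := Submodule.Quotient.mk_surjective _ x
  exact (Submodule.Quotient.mk_eq_zero _).2 (connesB_connesB_mem k A p x)

/-! ### Hochschild homology and de Rham cohomology -/

/-- Hochschild homology `HH_p(A)`, the homology of `(A ⊗ A^{⊗ •}, b)`. -/
abbrev HH (p : ℕ) : Type _ := Homology (hochschildB k A) p

/-- Hochschild homology `HH_p(A)`, computed by the normalized complex `(A ⊗ (A / k)^{⊗ •}, b)`,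
on which Connes' operator is defined. -/
abbrev NormalizedHH (p : ℕ) : Type _ := Homology (normalizedB k A) p

/-- The differential `H(B)` of Hochschild homology induced by Connes' operator. -/
def deRhamD (p : ℕ) : NormalizedHH k A p →ₗ[k] NormalizedHH k A (p + 1) :=
  homologyMap (normalizedB k A) (normalizedConnesB k A p)
    (raise_cycles (normalizedB_normalizedConnesB_zero k A) (normalizedB_normalizedConnesB k A) p)
    (raise_boundaries (normalizedB_normalizedConnesB k A) p)

/-- `H(B)² = 0`. -/
theorem deRhamD_deRhamD (p : ℕ) (x : NormalizedHH k A p) :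
    deRhamD k A (p + 1) (deRhamD k A p x) = 0 := by
  obtain ⟨⟨x, hx⟩, rfl⟩ := Submodule.Quotient.mk_surjective _ x
  refine (Submodule.Quotient.mk_eq_zero _).2 ?_
  change normalizedConnesB k A (p + 1) (normalizedConnesB k A p x) ∈ boundaries (normalizedB k A) (p + 2)
  rw [normalizedConnesB_normalizedConnesB]
  exact Submodule.zero_mem _

/-- The de Rham cohomology of `A`, the cohomology of `(HH_•(A), H(B))`. -/
abbrev DeRhamCohomology (p : ℕ) : Type _ := Cohomology (deRhamD k A) p

variable {k A} in
/-- The map `[F] ⌢ -` on Hochschild homology, for a derivation `F` of `A`. -/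
def capHH {F : A →ₗ[k] A} (hF : ∀ a b, F (a * b) = a * F b + F a * b) (p : ℕ) :
    HH k A (p + 1) →ₗ[k] HH k A p :=
  homologyMap (hochschildB k A) (cap k F p) (lower_cycles (hochschildB_cap hF) p)
    (lower_boundaries (hochschildB_cap hF) p)

variable {k A} in
/-- `([F] ⌢ -)² = 0` if `2` is invertible. -/
theorem capHH_capHH (h2 : IsUnit (2 : k)) {F : A →ₗ[k] A}
    (hF : ∀ a b, F (a * b) = a * F b + F a * b) (p : ℕ) (x : HH k A (p + 2)) :
    capHH hF p (capHH hF (p + 1) x) = 0 := by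
  obtain ⟨⟨x, hx⟩, rfl⟩ := Submodule.Quotient.mk_surjective _ x
  refine (Submodule.Quotient.mk_eq_zero _).2 ?_
  change cap k F p (cap k F (p + 1) x) ∈ LinearMap.range (hochschildB k A p)
  have hx' : hochschildB k A (p + 1) x = 0 := hx
  have h := two_smul_cap_cap hF p x
  rw [hx', map_zero, add_zero] at h
  obtain ⟨u, hu⟩ := h2
  rw [← hu] at h
  rw [← Submodule.smul_mem_iff_of_isUnit _ u.isUnit, h]
  exact LinearMap.mem_range_self _ _

end Hochschild

/-! ### Graded algebras -/

section Graded

variable {k : Type*} [CommRing k] {A : Type*} [Ring A] [Algebra k A] (𝒜 : ℕ → Submodule k A)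

/-- A graded algebra `A = ⨁ₚ Aₚ` is connected if `A₀ = k`. -/
def IsConnectedGraded : Prop := Set.BijOn (algebraMap k A) Set.univ (𝒜 0)

variable [GradedAlgebra 𝒜]

/-- The weight map (Euler derivation), `D a = p a` for `a ∈ Aₚ`. -/
def weightMap : A →ₗ[k] A :=
  DirectSum.toModule k ℕ A (fun p => (p : k) • (𝒜 p).subtype) ∘ₗ
    (DirectSum.decomposeLinearEquiv 𝒜).toLinearMap

theorem weightMap_of_mem {p : ℕ} {a : A} (ha : a ∈ 𝒜 p) : weightMap 𝒜 a = (p : k) • a := by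
  change DirectSum.toModule k ℕ A (fun p => (p : k) • (𝒜 p).subtype) (DirectSum.decompose 𝒜 a) = _
  rw [DirectSum.decompose_of_mem 𝒜 ha, ← DirectSum.lof_eq_of k, DirectSum.toModule_lof]
  rfl

theorem weightMap_mul (a b : A) :
    weightMap 𝒜 (a * b) = a * weightMap 𝒜 b + weightMap 𝒜 a * b := by
  induction a using DirectSum.Decomposition.inductionOn 𝒜 with
  | zero => simp
  | add a a' ha ha' => simp only [add_mul, map_add, ha, ha']; abel
  | homogeneous a =>
    induction b using DirectSum.Decomposition.inductionOn 𝒜 with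
    | zero => simp
    | add b b' hb hb' => simp only [mul_add, map_add, hb, hb']; abel
    | homogeneous b =>
      rw [weightMap_of_mem 𝒜 (SetLike.mul_mem_graded a.2 b.2), weightMap_of_mem 𝒜 a.2,
        weightMap_of_mem 𝒜 b.2, mul_smul_comm, smul_mul_assoc, ← add_smul, Nat.cast_add, add_comm]

/-- The higher Hochschild homology of `A`, the homology of `(HH_•(A), [D] ⌢ -)`
for the weight map `D`. -/
abbrev HigherHH (p : ℕ) : Type _ := Homology (capHH (weightMap_mul 𝒜)) p

end Graded

end GradedHochschild

end

/-!
Let `b` be the Hochschild differential, `B` Connes' operator, and let `e_D = D ⌢ -` for the Euler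
derivation `D`. The proof rests on Rinehart's homotopy formula
`e_D B + B e_D + b E + E b = L_D`, where `L_D` is the Lie derivative, which applies `D` to the
tensor factors one after the other, and `E` is an explicit operator of degree `1`
(`cartan_formula`, `cartan_formula_zero`).

On chains of degree `p`, let `s` be the insertion of `1` in front, `t` the signed rotation,
`N = ∑ tⁱ` its norm, `dᵢ` the signed faces for `i ≤ p`, `Dₘ` the map applying `D` to the entry `m`,
and `T_l` the sum of the `Dₘ` over the last `l` entries. Put `G = ∑_l tˡ T_l` and `E = -s G`. As
`B = s N`, `b s = 1 - t - s (∑_{i < p} dᵢ)` and `e_D s = t Dₚ`, the formula splits into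
`t G - G + t Dₚ N = L_D`, which is a telescoping sum (`turn_rotatedDeriv_sub`), and
`(∑_{i < p} dᵢ) G = G b - N e_D`, which follows from the relations between faces, rotations and
derivations (`sum_faceNat_rotatedDeriv`). Both hold already on unnormalized chains, so the
comparison between normalized and unnormalized Hochschild homology is never needed; all the
operators preserve degenerate chains, and the formula descends.

So `H(B)` and `[D] ⌢ -` are contracting homotopies for each other away from the kernel of `L_D`.
A tensor product of homogeneous elements is an eigenvector of `L_D` for its total weight, and by
connectedness the ones of weight `0` are the multiples of `1 ⊗ ⋯ ⊗ 1`. Hence, in characteristic `0`,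
each chain is sent to the line of `1 ⊗ ⋯ ⊗ 1` by some polynomial in `L_D` with nonzero constant term
(`exists_aeval_mem`). If `I ≤ J` are boundaries and cycles for the complex in question, `L_D` maps
`J` to `I`, and then each cycle is a boundary up to a multiple of `1 ⊗ ⋯ ⊗ 1`
(`mem_sup_of_aeval_mem`). In positive degree that multiple is itself a Hochschild boundary, or
degenerate. In degree `0` it survives, as the projection `A → A₀` kills commutators and the image
of `D`.
-/

noncomputable section

namespace GradedHochschild

/-! ### Applying a map to one entry of a tuple -/

section Tuples

variable (k : Type*) [CommRing k] {A : Type*} [Ring A] [Algebra k A]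

/-- The tuple `a` with its entry at the position `m` replaced by its image under `F`; positions are
natural numbers, and nothing happens if `m` is out of range. -/
def applyAt (F : A → A) (m : ℕ) {n : ℕ} (a : Fin n → A) : Fin n → A :=
  fun j => if (j : ℕ) = m then F (a j) else a j

theorem applyAt_update (F : A →ₗ[k] A) (m : ℕ) {n : ℕ} (a : Fin n → A) (i : Fin n) :
    ∃ (j : Fin n) (L : A →ₗ[k] A), ∀ v,
      applyAt F m (Function.update a i v) = Function.update (applyAt F m a) j (L v) := by
  refine ⟨i, if (i : ℕ) = m then F else LinearMap.id, fun v => ?_⟩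
  funext j
  simp only [applyAt, Function.update_apply]
  by_cases hj : j = i
  · subst hj
    split_ifs <;> simp_all
  · simp [hj]

theorem face_applyAt_of_lt (F : A → A) {p m r : ℕ} (hr : r < p + 2) (hm : m < r)
    (h : r < p + 1 ∨ 0 < m) (a : Fin (p + 2) → A) :
    face ⟨r, hr⟩ (applyAt F m a) = applyAt F m (face ⟨r, hr⟩ a) := by
  obtain ⟨a, rfl⟩ := exists_seq a
  have h1 : ∀ n, applyAt F m (fun j : Fin n => a j) =
    fun j : Fin n => if (j : ℕ) = m then F (a j) else a j := fun n => rfl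
  rw [h1, face_seq (a := fun j => if j = m then F (a j) else a j), face_seq]
  funext l
  obtain ⟨l, hl⟩ := l
  simp only [applyAt, faceSeq]
  grind

theorem face_applyAt_of_gt (F : A → A) {p m r : ℕ} (hr : r < p + 1) (hm : r < m)
    (a : Fin (p + 2) → A) :
    face ⟨r, by omega⟩ (applyAt F (m + 1) a) = applyAt F m (face ⟨r, by omega⟩ a) := by
  obtain ⟨a, rfl⟩ := exists_seq a
  change face _ (fun j : Fin (p + 2) => if (j : ℕ) = m + 1 then F (a j) else a j) = _
  rw [face_seq (a := fun j => if j = m + 1 then F (a j) else a j), face_seq]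
  funext l
  obtain ⟨l, hl⟩ := l
  simp only [applyAt, faceSeq]
  grind

theorem face_applyAt_left (F : A → A) {p r : ℕ} (hr : r < p + 1) (a : Fin (p + 2) → A) :
    face ⟨r, by omega⟩ (applyAt F r a) = Function.update (face ⟨r, by omega⟩ a) ⟨r, hr⟩
      (F (a ⟨r, by omega⟩) * a ⟨r + 1, by omega⟩) := by
  obtain ⟨a, rfl⟩ := exists_seq a
  change face _ (fun j : Fin (p + 2) => if (j : ℕ) = r then F (a j) else a j) = _
  rw [face_seq (a := fun j => if j = r then F (a j) else a j), face_seq]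
  funext l
  obtain ⟨l, hl⟩ := l
  simp only [Function.update_apply, Fin.mk.injEq, faceSeq]
  grind

theorem face_applyAt_right (F : A → A) {p r : ℕ} (hr : r < p + 1) (a : Fin (p + 2) → A) :
    face ⟨r, by omega⟩ (applyAt F (r + 1) a) = Function.update (face ⟨r, by omega⟩ a) ⟨r, hr⟩
      (a ⟨r, by omega⟩ * F (a ⟨r + 1, by omega⟩)) := by
  obtain ⟨a, rfl⟩ := exists_seq a
  change face _ (fun j : Fin (p + 2) => if (j : ℕ) = r + 1 then F (a j) else a j) = _
  rw [face_seq (a := fun j => if j = r + 1 then F (a j) else a j), face_seq]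
  funext l
  obtain ⟨l, hl⟩ := l
  simp only [Function.update_apply, Fin.mk.injEq, faceSeq]
  grind

theorem applyAt_face (F : A → A) {p r : ℕ} (hr : r < p + 1) (a : Fin (p + 2) → A) :
    applyAt F r (face ⟨r, by omega⟩ a) = Function.update (face ⟨r, by omega⟩ a) ⟨r, hr⟩
      (F (a ⟨r, by omega⟩ * a ⟨r + 1, by omega⟩)) := by
  obtain ⟨a, rfl⟩ := exists_seq a
  rw [face_seq]
  funext l
  obtain ⟨l, hl⟩ := l
  simp only [Function.update_apply, Fin.mk.injEq, applyAt, faceSeq]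
  grind

theorem rotate_one_applyAt (F : A → A) {p m : ℕ} (hm : m < p) (a : Fin (p + 1) → A) :
    rotate 1 (applyAt F m a) = applyAt F (m + 1) (rotate 1 a) := by
  obtain ⟨a, rfl⟩ := exists_seq a
  change rotate 1 (fun j : Fin (p + 1) => if (j : ℕ) = m then F (a j) else a j) = _
  rw [turn_seq (a := fun j => if j = m then F (a j) else a j), turn_seq]
  funext l
  obtain ⟨l, hl⟩ := l
  simp only [applyAt, turnSeq]
  grind

theorem wrap_eq_face_applyAt (F : A → A) {p : ℕ} (a : Fin (p + 2) → A) :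
    wrap F a = face (Fin.last (p + 1)) (applyAt F (p + 1) a) := by
  funext l
  have := l.2
  by_cases hl : l = 0
  · simp [face, wrap, applyAt, hl]
  · simp only [face, wrap, applyAt, hl, if_true, if_false, Fin.val_castSucc]
    rw [if_neg (by omega)]

theorem wrap_cons_one (F : A → A) {p : ℕ} (a : Fin (p + 1) → A) :
    wrap F (Fin.cons 1 a : Fin (p + 2) → A) = rotate 1 (applyAt F p a) := by
  obtain ⟨a, rfl⟩ := exists_seq a
  have h : (Fin.cons 1 fun j : Fin (p + 1) => a j : Fin (p + 2) → A) =
      fun j : Fin (p + 2) => (fun j : ℕ => if j = 0 then 1 else a (j - 1)) j := by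
    funext l
    refine Fin.cases ?_ (fun l => ?_) l <;> simp
  change _ = rotate 1 (fun j : Fin (p + 1) => if (j : ℕ) = p then F (a j) else a j)
  rw [turn_seq (a := fun j => if j = p then F (a j) else a j), h,
    wrap_seq (a := fun j => if j = 0 then 1 else a (j - 1))]
  funext l
  obtain ⟨l, hl⟩ := l
  simp only [wrapSeq, turnSeq]
  grind

end Tuples

/-! ### Derivations, faces and rotations of chains -/

section Operators

variable (k : Type*) [CommRing k] {A : Type*} [Ring A] [Algebra k A]

/-- `F` applied to the tensor factor at the position `m ≤ p` (for `m > p` this is the identity). -/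
def derivAt (F : A →ₗ[k] A) (p m : ℕ) : Module.End k (Chains k A p) :=
  tensorMap k (applyAt F m) (applyAt_update k F m)

theorem derivAt_tprod (F : A →ₗ[k] A) (p m : ℕ) (a : Fin (p + 1) → A) :
    derivAt k F p m (PiTensorProduct.tprod k a) = PiTensorProduct.tprod k (applyAt F m a) := by
  simp [derivAt]

theorem signedFace_tprod {p : ℕ} (i : Fin (p + 2)) (a : Fin (p + 2) → A) :
    signedFace k i (PiTensorProduct.tprod k a) =
      (-1 : k) ^ (i : ℕ) • PiTensorProduct.tprod k (face i a) := by
  simp [signedFace]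

theorem turn_tprod (p : ℕ) (a : Fin (p + 1) → A) :
    turn k p (PiTensorProduct.tprod k a) =
      (-1 : k) ^ p • PiTensorProduct.tprod k (rotate 1 a) := by
  simp [turn]

theorem signedFace_derivAt_of_lt (F : A →ₗ[k] A) {p m r : ℕ} (hr : r < p + 2) (hm : m < r)
    (h : r < p + 1 ∨ 0 < m) (x : Chains k A (p + 1)) :
    signedFace k ⟨r, hr⟩ (derivAt k F (p + 1) m x) =
      derivAt k F p m (signedFace k ⟨r, hr⟩ x) := by
  refine eq_of_tprod (f := signedFace k ⟨r, hr⟩ ∘ₗ derivAt k F (p + 1) m)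
    (g := derivAt k F p m ∘ₗ signedFace k ⟨r, hr⟩) (fun a => ?_) x
  simp only [LinearMap.comp_apply, derivAt_tprod, signedFace_tprod, map_smul,
    face_applyAt_of_lt F hr hm h]

theorem signedFace_derivAt_of_gt (F : A →ₗ[k] A) {p m r : ℕ} (hr : r < p + 1) (hm : r < m)
    (x : Chains k A (p + 1)) :
    signedFace k ⟨r, by omega⟩ (derivAt k F (p + 1) (m + 1) x) =
      derivAt k F p m (signedFace k ⟨r, by omega⟩ x) := by
  refine eq_of_tprod (f := signedFace k ⟨r, by omega⟩ ∘ₗ derivAt k F (p + 1) (m + 1))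
    (g := derivAt k F p m ∘ₗ signedFace k ⟨r, by omega⟩) (fun a => ?_) x
  simp only [LinearMap.comp_apply, derivAt_tprod, signedFace_tprod, map_smul,
    face_applyAt_of_gt F hr hm]

variable {k} in
theorem signedFace_derivAt_add {F : A →ₗ[k] A} (hF : ∀ a b, F (a * b) = a * F b + F a * b)
    {p r : ℕ} (hr : r < p + 1) (x : Chains k A (p + 1)) :
    signedFace k ⟨r, by omega⟩ (derivAt k F (p + 1) r x) +
      signedFace k ⟨r, by omega⟩ (derivAt k F (p + 1) (r + 1) x) =
      derivAt k F p r (signedFace k ⟨r, by omega⟩ x) := by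
  refine eq_of_tprod (f := signedFace k ⟨r, by omega⟩ ∘ₗ derivAt k F (p + 1) r +
      signedFace k ⟨r, by omega⟩ ∘ₗ derivAt k F (p + 1) (r + 1))
    (g := derivAt k F p r ∘ₗ signedFace k ⟨r, by omega⟩) (fun a => ?_) x
  simp only [LinearMap.comp_apply, LinearMap.add_apply, derivAt_tprod, signedFace_tprod, map_smul]
  rw [face_applyAt_left F hr, face_applyAt_right F hr, applyAt_face F hr, hF,
    MultilinearMap.map_update_add, smul_add, add_comm]

theorem turn_derivAt (F : A →ₗ[k] A) {p m : ℕ} (hm : m < p) (x : Chains k A p) :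
    turn k p (derivAt k F p m x) = derivAt k F p (m + 1) (turn k p x) := by
  refine eq_of_tprod (f := turn k p ∘ₗ derivAt k F p m)
    (g := derivAt k F p (m + 1) ∘ₗ turn k p) (fun a => ?_) x
  simp only [LinearMap.comp_apply, derivAt_tprod, turn_tprod, map_smul,
    rotate_one_applyAt F hm]

theorem derivAt_turn_pow (F : A →ₗ[k] A) {p m n : ℕ} (hm : m + n ≤ p) (x : Chains k A p) :
    derivAt k F p (m + n) ((turn k p ^ n) x) = (turn k p ^ n) (derivAt k F p m x) := by
  induction n with
  | zero => rfl
  | succ n ih =>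
    rw [pow_succ', Module.End.mul_apply, ← add_assoc, ← turn_derivAt k F (by omega),
      ih (by omega), Module.End.mul_apply]

theorem cap_eq (F : A →ₗ[k] A) (p : ℕ) (x : Chains k A (p + 1)) :
    cap k F p x = -signedFace k ⟨p + 1, by omega⟩ (derivAt k F (p + 1) (p + 1) x) := by
  refine eq_of_tprod (g := -(signedFace k ⟨p + 1, by omega⟩ ∘ₗ derivAt k F (p + 1) (p + 1)))
    (fun a => ?_) x
  rw [LinearMap.neg_apply, LinearMap.comp_apply, derivAt_tprod, signedFace_tprod, cap_tprod,
    wrap_eq_face_applyAt, pow_succ, mul_neg_one, neg_smul, neg_neg]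
  rfl

theorem cap_consOne (F : A →ₗ[k] A) (p : ℕ) (x : Chains k A p) :
    cap k F p (consOne k p x) = turn k p (derivAt k F p p x) := by
  refine eq_of_tprod (f := cap k F p ∘ₗ consOne k p) (g := turn k p ∘ₗ derivAt k F p p)
    (fun a => ?_) x
  simp only [LinearMap.comp_apply, derivAt_tprod, turn_tprod, consOne, tensorMap_tprod, cap_tprod,
    wrap_cons_one]

theorem signedFace_turn {p i : ℕ} (hi : i < p + 1) (x : Chains k A (p + 1)) :
    signedFace k ⟨i + 1, by omega⟩ (turn k (p + 1) x) =
      turn k p (signedFace k ⟨i, by omega⟩ x) := by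
  refine eq_of_tprod (f := signedFace k ⟨i + 1, by omega⟩ ∘ₗ turn k (p + 1))
    (g := turn k p ∘ₗ signedFace k ⟨i, by omega⟩) (fun a => ?_) x
  have := face_turn ⟨i, hi⟩ a
  simp only [Fin.succ_mk, Fin.castSucc_mk] at this
  simp only [LinearMap.comp_apply, signedFace_tprod, turn_tprod, map_smul, smul_smul, this]
  congr 1
  ring

theorem signedFace_zero_turn {p : ℕ} (x : Chains k A (p + 1)) :
    signedFace k 0 (turn k (p + 1) x) = signedFace k ⟨p + 1, by omega⟩ x := by
  refine eq_of_tprod (f := signedFace k 0 ∘ₗ turn k (p + 1))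
    (g := signedFace k ⟨p + 1, by omega⟩) (fun a => ?_) x
  simp only [LinearMap.comp_apply, signedFace_tprod, turn_tprod, map_smul, face_zero_turn]
  simp
  rfl

theorem signedFace_turn_pow_add {p l r : ℕ} (h : l + r < p + 2) (x : Chains k A (p + 1)) :
    signedFace k ⟨l + r, h⟩ ((turn k (p + 1) ^ l) x) =
      (turn k p ^ l) (signedFace k ⟨r, by omega⟩ x) := by
  induction l with
  | zero => simp
  | succ l ih =>
    have h1 : (⟨l + 1 + r, h⟩ : Fin (p + 2)) = ⟨l + r + 1, by omega⟩ := Fin.ext (by simp; omega)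
    rw [pow_succ', Module.End.mul_apply, h1, signedFace_turn k (by omega), ih, pow_succ',
      Module.End.mul_apply]

/-- The case in which the rotation moves more than `i` factors to the front: one rotation is used up
in turning the face `0` into the last face. -/
theorem signedFace_turn_pow_succ {p l i : ℕ} (hi : i < l + 1) (hl : l < p + 1)
    (x : Chains k A (p + 1)) :
    signedFace k ⟨i, by omega⟩ ((turn k (p + 1) ^ (l + 1)) x) =
      (turn k p ^ l) (signedFace k ⟨p + 1 - l + i, by omega⟩ x) := by
  obtain ⟨j, rfl⟩ : ∃ j, l = i + j := ⟨l - i, by omega⟩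
  have h1 := signedFace_turn_pow_add k (l := i) (r := 0) (by omega)
    ((turn k (p + 1) ^ (j + 1)) x)
  have h2 := signedFace_turn_pow_add k (p := p) (l := j) (r := p + 1 - j) (by omega) x
  have h3 : (⟨j + (p + 1 - j), by omega⟩ : Fin (p + 2)) = ⟨p + 1, by omega⟩ :=
    Fin.ext (by simp; omega)
  have h4 : (⟨p + 1 - (i + j) + i, by omega⟩ : Fin (p + 2)) = ⟨p + 1 - j, by omega⟩ :=
    Fin.ext (by simp; omega)
  rw [h3] at h2
  rw [add_assoc i j 1, pow_add, Module.End.mul_apply, pow_add (turn k p),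
    Module.End.mul_apply, h4, ← h2]
  refine h1.trans ?_
  congr 1
  rw [pow_succ', Module.End.mul_apply]
  exact signedFace_zero_turn k _

/-- The signed face `signedFace k i` with a natural number as its index. The index is reduced modulo
`p + 2`, and only `i < p + 2` is used. -/
def faceNat (p i : ℕ) : Chains k A (p + 1) →ₗ[k] Chains k A p :=
  signedFace k (Fin.ofNat (p + 2) i)

theorem faceNat_eq {p i : ℕ} (h : i < p + 2) :
    (faceNat k p i : Chains k A (p + 1) →ₗ[k] Chains k A p) = signedFace k ⟨i, h⟩ := by
  rw [faceNat]
  congr 1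
  exact Fin.ext (Nat.mod_eq_of_lt h)

theorem hochschildB_eq_sum_faceNat (p : ℕ) :
    hochschildB k A p = ∑ i ∈ Finset.range (p + 2), faceNat k p i := by
  rw [hochschildB_eq_sum, Finset.sum_range]
  exact Finset.sum_congr rfl fun i _ => (faceNat_eq k i.2).symm

theorem sum_signedFace_castSucc (p : ℕ) :
    ∑ i : Fin (p + 1), (signedFace k i.castSucc : Chains k A (p + 1) →ₗ[k] Chains k A p) =
      ∑ i ∈ Finset.range (p + 1), faceNat k p i := by
  rw [Finset.sum_range]
  exact Finset.sum_congr rfl fun i _ => (faceNat_eq k i.castSucc.2).symm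

end Operators

/-! ### The homotopy formula -/

section Cartan

variable (k : Type*) [CommRing k] {A : Type*} [Ring A] [Algebra k A]

/-- The sum over the last `l` tensor factors of `F` applied to that factor, for `l ≤ p + 1`. -/
def tailDeriv (F : A →ₗ[k] A) (p l : ℕ) : Module.End k (Chains k A p) :=
  ∑ i ∈ Finset.range l, derivAt k F p (p - i)

theorem tailDeriv_zero (F : A →ₗ[k] A) (p : ℕ) : tailDeriv k F p 0 = 0 := rfl

theorem tailDeriv_succ (F : A →ₗ[k] A) (p l : ℕ) :
    tailDeriv k F p (l + 1) = tailDeriv k F p l + derivAt k F p (p - l) :=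
  Finset.sum_range_succ _ _

/-- The Lie derivative along `F`: the sum over all tensor factors of `F` applied to that factor. -/
def lieDeriv (F : A →ₗ[k] A) (p : ℕ) : Module.End k (Chains k A p) :=
  tailDeriv k F p (p + 1)

/-- The `r`-th face multiplies two factors which are both before the last `l`. -/
theorem faceNat_tailDeriv_of_le (F : A →ₗ[k] A) {p r l : ℕ} (h : r + l ≤ p)
    (x : Chains k A (p + 1)) :
    faceNat k p r (tailDeriv k F (p + 1) l x) = tailDeriv k F p l (faceNat k p r x) := by
  rw [faceNat_eq k (by omega)]
  simp only [tailDeriv, LinearMap.sum_apply, map_sum]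
  refine Finset.sum_congr rfl fun i hi => ?_
  have hi := Finset.mem_range.1 hi
  rw [show p + 1 - i = p - i + 1 by omega, signedFace_derivAt_of_gt k F (by omega) (by omega)]

variable {k} in
/-- The `r`-th face multiplies two of the last `l + 1` factors, which leaves `l` of them. -/
theorem faceNat_tailDeriv_succ {F : A →ₗ[k] A} (hF : ∀ a b, F (a * b) = a * F b + F a * b)
    {p r l : ℕ} (hr : r < p + 1) (h : p + 1 ≤ r + l) (hl : l ≤ p + 1) (x : Chains k A (p + 1)) :
    faceNat k p r (tailDeriv k F (p + 1) (l + 1) x) = tailDeriv k F p l (faceNat k p r x) := by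
  obtain ⟨n, rfl⟩ : ∃ n, p = r + n := ⟨p - r, by omega⟩
  replace h : n + 1 ≤ l := by omega
  induction l, h using Nat.le_induction with
  | base =>
    have h1 := faceNat_tailDeriv_of_le k F (p := r + n) (r := r) (l := n) le_rfl x
    have h2 := signedFace_derivAt_add hF hr x
    rw [faceNat_eq k (by omega)] at h1 ⊢
    rw [tailDeriv_succ, tailDeriv_succ, tailDeriv_succ, show r + n + 1 - (n + 1) = r by omega,
      show r + n + 1 - n = r + 1 by omega, show r + n - n = r by omega]
    simp only [LinearMap.add_apply, map_add]
    rw [h1, ← h2]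
    abel
  | succ l hl' ih =>
    rw [tailDeriv_succ k F (r + n + 1) (l + 1), tailDeriv_succ k F (r + n) l, LinearMap.add_apply,
      map_add, ih (by omega), faceNat_eq k (by omega),
      show r + n + 1 - (l + 1) = r + n - l by omega,
      signedFace_derivAt_of_lt k F _ (by omega) (by omega), LinearMap.add_apply]

/-- The last face moves the last factor to the front. The term in which `F` is applied to that
factor gives the cap product. -/
theorem faceNat_last_tailDeriv_succ (F : A →ₗ[k] A) {p l : ℕ} (hl : l ≤ p)
    (x : Chains k A (p + 1)) :
    faceNat k p (p + 1) (tailDeriv k F (p + 1) (l + 1) x) =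
      tailDeriv k F p l (faceNat k p (p + 1) x) - cap k F p x := by
  rw [faceNat_eq k (by omega), cap_eq, sub_neg_eq_add]
  simp only [tailDeriv, LinearMap.sum_apply, map_sum]
  rw [Finset.sum_range_succ']
  congr 1
  refine Finset.sum_congr rfl fun i hi => ?_
  have hi := Finset.mem_range.1 hi
  rw [show p + 1 - (i + 1) = p - i by omega,
    signedFace_derivAt_of_lt k F _ (by omega) (by omega)]

/-- The operator `∑_{l ≤ p} tˡ T_l`, where `t` is the signed rotation and `T_l` is
`tailDeriv k F p l`: a block of the last `l` factors is moved to the front, and `F` is applied to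
one of the factors in the block. -/
def rotatedDeriv (F : A →ₗ[k] A) (p : ℕ) : Module.End k (Chains k A p) :=
  ∑ l ∈ Finset.range (p + 1), turn k p ^ l * tailDeriv k F p l

/-- The sum telescopes, as `T_{l+1}` is `T_l` plus `F` applied at the position `p - l`, and `F`
applied at the end of a chain rotated `l` times is `F` applied at `p - l` before the rotation. -/
theorem turn_rotatedDeriv_sub (F : A →ₗ[k] A) (p : ℕ) (x : Chains k A p) :
    turn k p (rotatedDeriv k F p x) - rotatedDeriv k F p x +
      turn k p (derivAt k F p p (norm k p x)) = lieDeriv k F p x := by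
  have h : ∀ l ∈ Finset.range (p + 1), turn k p (derivAt k F p p ((turn k p ^ l) x)) =
      (turn k p ^ (l + 1)) (derivAt k F p (p - l) x) := by
    intro l hl
    have hl := Finset.mem_range.1 hl
    have := derivAt_turn_pow k F (p := p) (m := p - l) (n := l) (by omega) x
    rw [Nat.sub_add_cancel (by omega)] at this
    rw [this, pow_succ', Module.End.mul_apply]
  have h2 : ∑ l ∈ Finset.range (p + 1), ((turn k p ^ (l + 1)) (tailDeriv k F p (l + 1) x) -
      (turn k p ^ l) (tailDeriv k F p l x)) = lieDeriv k F p x := by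
    rw [Finset.sum_range_sub (fun l => (turn k p ^ l) (tailDeriv k F p l x)), turn_pow_card,
      tailDeriv_zero, LinearMap.zero_apply, map_zero, sub_zero]
    rfl
  rw [← h2, norm, rotatedDeriv]
  simp only [LinearMap.sum_apply, map_sum]
  rw [Finset.sum_congr rfl h, ← Finset.sum_sub_distrib, ← Finset.sum_add_distrib]
  refine Finset.sum_congr rfl fun l _ => ?_
  rw [tailDeriv_succ, LinearMap.add_apply, map_add, pow_succ']
  simp only [Module.End.mul_apply]
  abel

variable {k} in
theorem sum_faceNat_tailDeriv {F : A →ₗ[k] A} (hF : ∀ a b, F (a * b) = a * F b + F a * b)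
    {p l : ℕ} (hl : l ≤ p) (x : Chains k A (p + 1)) :
    ∑ i ∈ Finset.range (l + 1), faceNat k p (p + 1 - l + i) (tailDeriv k F (p + 1) (l + 1) x) +
      ∑ r ∈ Finset.range (p + 1 - l), faceNat k p r (tailDeriv k F (p + 1) l x) =
      tailDeriv k F p l (hochschildB k A p x) - cap k F p x := by
  have h1 : hochschildB k A p x = ∑ r ∈ Finset.range (p + 1 - l), faceNat k p r x +
      (∑ i ∈ Finset.range l, faceNat k p (p + 1 - l + i) x + faceNat k p (p + 1) x) := by
    have h2 : Finset.range (p + 2) = Finset.range (p + 1 - l + (l + 1)) := by congr 1; omega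
    rw [hochschildB_eq_sum_faceNat, LinearMap.sum_apply, h2, Finset.sum_range_add,
      Finset.sum_range_succ _ l, Nat.sub_add_cancel (by omega)]
  rw [h1, Finset.sum_range_succ, Nat.sub_add_cancel (by omega), faceNat_last_tailDeriv_succ k F hl,
    map_add, map_add, map_sum, map_sum]
  rw [Finset.sum_congr rfl fun i hi => faceNat_tailDeriv_succ hF
      (by have := Finset.mem_range.1 hi; omega) (by omega) (by omega) x,
    Finset.sum_congr rfl fun r hr => faceNat_tailDeriv_of_le k F
      (by have := Finset.mem_range.1 hr; omega) x]
  abel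

variable {k} in
theorem sum_faceNat_rotatedDeriv {F : A →ₗ[k] A} (hF : ∀ a b, F (a * b) = a * F b + F a * b)
    (p : ℕ) (x : Chains k A (p + 1)) :
    ∑ i ∈ Finset.range (p + 1), faceNat k p i (rotatedDeriv k F (p + 1) x) =
      rotatedDeriv k F p (hochschildB k A p x) - norm k p (cap k F p x) := by
  have hU : ∀ l ∈ Finset.range (p + 1), ∑ i ∈ Finset.range (p + 1 - l),
      faceNat k p (l + i) ((turn k (p + 1) ^ l) (tailDeriv k F (p + 1) l x)) =
      (turn k p ^ l) (∑ r ∈ Finset.range (p + 1 - l),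
        faceNat k p r (tailDeriv k F (p + 1) l x)) := by
    intro l hl
    rw [map_sum]
    refine Finset.sum_congr rfl fun i hi => ?_
    have hl := Finset.mem_range.1 hl
    have hi := Finset.mem_range.1 hi
    rw [faceNat_eq k (by omega), signedFace_turn_pow_add, faceNat_eq k (by omega)]
  have hV : ∀ l ∈ Finset.range (p + 1), ∑ i ∈ Finset.range (l + 1),
      faceNat k p i ((turn k (p + 1) ^ (l + 1)) (tailDeriv k F (p + 1) (l + 1) x)) =
      (turn k p ^ l) (∑ i ∈ Finset.range (l + 1),
        faceNat k p (p + 1 - l + i) (tailDeriv k F (p + 1) (l + 1) x)) := by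
    intro l hl
    rw [map_sum]
    refine Finset.sum_congr rfl fun i hi => ?_
    have hl := Finset.mem_range.1 hl
    have hi := Finset.mem_range.1 hi
    rw [faceNat_eq k (by omega), signedFace_turn_pow_succ k hi hl, faceNat_eq k (by omega)]
  have hsplit : ∀ l ∈ Finset.range (p + 2), ∑ i ∈ Finset.range (p + 1),
      faceNat k p i ((turn k (p + 1) ^ l) (tailDeriv k F (p + 1) l x)) =
      ∑ i ∈ Finset.range l,
        faceNat k p i ((turn k (p + 1) ^ l) (tailDeriv k F (p + 1) l x)) +
      ∑ i ∈ Finset.range (p + 1 - l),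
        faceNat k p (l + i) ((turn k (p + 1) ^ l) (tailDeriv k F (p + 1) l x)) := by
    intro l hl
    have hl := Finset.mem_range.1 hl
    rw [← Finset.sum_range_add, Nat.add_sub_cancel' (by omega)]
  simp only [rotatedDeriv, norm, LinearMap.sum_apply, map_sum, Module.End.mul_apply]
  -- Rotations `tˡ` contribute `tˡ⁻¹` for the faces of index below `l` and `tˡ` for the others; the
  -- first sum is shifted by one in `l`.
  rw [Finset.sum_comm, Finset.sum_congr rfl hsplit, Finset.sum_add_distrib,
    Finset.sum_range_succ' _ (p + 1), Finset.sum_range_succ _ (p + 1), Nat.sub_self,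
    Finset.sum_range_zero, Finset.sum_range_zero, add_zero, add_zero, Finset.sum_congr rfl hU,
    Finset.sum_congr rfl hV, ← Finset.sum_add_distrib, ← Finset.sum_sub_distrib]
  refine Finset.sum_congr rfl fun l hl => ?_
  have hl := Finset.mem_range.1 hl
  rw [← map_add, sum_faceNat_tailDeriv hF (by omega), map_sub]

/-- The operator `E` of the homotopy formula. -/
def cartanE (F : A →ₗ[k] A) (p : ℕ) : Chains k A p →ₗ[k] Chains k A (p + 1) :=
  -(consOne k p ∘ₗ rotatedDeriv k F p)

variable {k} in
/-- Rinehart's homotopy formula, in positive degrees, on unnormalized chains. -/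
theorem cartan_formula {F : A →ₗ[k] A} (hF : ∀ a b, F (a * b) = a * F b + F a * b)
    (p : ℕ) (x : Chains k A (p + 1)) :
    cap k F (p + 1) (connesB k A (p + 1) x) + connesB k A p (cap k F p x) +
      (hochschildB k A (p + 1) (cartanE k F (p + 1) x) +
        cartanE k F p (hochschildB k A p x)) = lieDeriv k F (p + 1) x := by
  simp only [cartanE, LinearMap.neg_apply, LinearMap.comp_apply, map_neg]
  rw [connesB_eq, connesB_eq, cap_consOne, hochschildB_consOne, ← turn_rotatedDeriv_sub,
    ← LinearMap.sum_apply, sum_signedFace_castSucc, LinearMap.sum_apply,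
    sum_faceNat_rotatedDeriv hF, map_sub]
  abel

/-- Rinehart's homotopy formula in degree `0`, where `E` vanishes. -/
theorem cartan_formula_zero (F : A →ₗ[k] A) (x : Chains k A 0) :
    cap k F 0 (connesB k A 0 x) = lieDeriv k F 0 x := by
  rw [connesB_eq, cap_consOne, ← turn_rotatedDeriv_sub]
  simp [rotatedDeriv, tailDeriv_zero]

end Cartan

/-! ### Degenerate chains -/

section Degenerate

variable (k : Type*) [CommRing k] {A : Type*} [Ring A] [Algebra k A]

theorem degenerate_le_comap_cap {F : A →ₗ[k] A} (hF : F 1 = 0) (p : ℕ) :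
    degenerate k A (p + 1) ≤ (degenerate k A p).comap (cap k F p) := by
  refine Submodule.span_le.2 ?_
  rintro _ ⟨a, i, hi, ha, rfl⟩
  rw [SetLike.mem_coe, Submodule.mem_comap, cap_tprod]
  refine Submodule.smul_mem _ _ ?_
  rcases Fin.eq_castSucc_or_eq_last i with ⟨j, rfl⟩ | rfl
  · have hj : j ≠ 0 := fun h => hi (by simp [h])
    exact tprod_mem_degenerate k A _ j hj (by simp [wrap, hj, ha])
  · rw [(PiTensorProduct.tprod k).map_coord_zero 0 (by simp [wrap, ha, hF])]
    exact Submodule.zero_mem _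

variable (A) in
/-- The span of the `a₀ ⊗ ⋯ ⊗ a_p` with `aᵢ = 1` for some `i`, where the case `i = 0` is
allowed. Unlike `degenerate k A p`, it is stable under rotation. -/
def unitSpan (p : ℕ) : Submodule k (Chains k A p) :=
  Submodule.span k
    {x | ∃ (a : Fin (p + 1) → A) (i : Fin (p + 1)), a i = 1 ∧ x = PiTensorProduct.tprod k a}

theorem degenerate_le_unitSpan (p : ℕ) : degenerate k A p ≤ unitSpan k A p :=
  Submodule.span_mono fun _ ⟨a, i, _, ha, hx⟩ => ⟨a, i, ha, hx⟩

theorem unitSpan_le_comap_turn (p : ℕ) :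
    unitSpan k A p ≤ (unitSpan k A p).comap (turn k p) := by
  refine Submodule.span_le.2 ?_
  rintro _ ⟨a, i, ha, rfl⟩
  rw [SetLike.mem_coe, Submodule.mem_comap, turn_tprod]
  exact Submodule.smul_mem _ _ (Submodule.subset_span ⟨_, i + 1, by simp [rotate, ha], rfl⟩)

theorem unitSpan_le_comap_derivAt {F : A →ₗ[k] A} (hF : F 1 = 0) (p m : ℕ) :
    unitSpan k A p ≤ (unitSpan k A p).comap (derivAt k F p m) := by
  refine Submodule.span_le.2 ?_
  rintro _ ⟨a, i, ha, rfl⟩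
  rw [SetLike.mem_coe, Submodule.mem_comap, derivAt_tprod]
  by_cases hi : (i : ℕ) = m
  · rw [(PiTensorProduct.tprod k).map_coord_zero i (by simp [applyAt, hi, ha, hF])]
    exact Submodule.zero_mem _
  · exact Submodule.subset_span ⟨_, i, by simp [applyAt, hi, ha], rfl⟩

theorem unitSpan_le_comap_consOne (p : ℕ) :
    unitSpan k A p ≤ (degenerate k A (p + 1)).comap (consOne k p) := by
  refine Submodule.span_le.2 ?_
  rintro _ ⟨a, i, ha, rfl⟩
  rw [SetLike.mem_coe, Submodule.mem_comap, consOne, tensorMap_tprod]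
  exact tprod_mem_degenerate k A _ i.succ (Fin.succ_ne_zero i) (by simp [ha])

theorem degenerate_le_comap_cartanE {F : A →ₗ[k] A} (hF : F 1 = 0) (p : ℕ) :
    degenerate k A p ≤ (degenerate k A (p + 1)).comap (cartanE k F p) := by
  intro x hx
  rw [Submodule.mem_comap, cartanE, LinearMap.neg_apply, LinearMap.comp_apply]
  refine Submodule.neg_mem _ (unitSpan_le_comap_consOne k p ?_)
  rw [rotatedDeriv, LinearMap.sum_apply]
  refine Submodule.sum_mem _ fun l _ => ?_
  rw [Module.End.mul_apply]
  have h1 : tailDeriv k F p l x ∈ unitSpan k A p := by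
    rw [tailDeriv, LinearMap.sum_apply]
    exact Submodule.sum_mem _ fun i _ =>
      unitSpan_le_comap_derivAt k hF p _ (degenerate_le_unitSpan k p hx)
  exact Module.End.pow_apply_mem_of_forall_mem l (unitSpan_le_comap_turn k p) _ h1

end Degenerate

/-! ### Eigenvectors of the Lie derivative -/

section Weight

variable (k : Type*) [CommRing k] {A : Type*} [Ring A] [Algebra k A]

theorem lieDeriv_eq_sum (F : A →ₗ[k] A) (p : ℕ) :
    lieDeriv k F p = ∑ m : Fin (p + 1), derivAt k F p m := by
  rw [lieDeriv, tailDeriv, ← Finset.sum_range (fun m => derivAt k F p m),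
    ← Finset.sum_range_reflect]
  exact Finset.sum_congr rfl fun i hi => by
    have := Finset.mem_range.1 hi
    rw [show p - (p + 1 - 1 - i) = i by omega]

variable {k} in
theorem lieDeriv_tprod_of_eigen {F : A →ₗ[k] A} {p : ℕ} {a : Fin (p + 1) → A}
    {c : Fin (p + 1) → k} (h : ∀ i, F (a i) = c i • a i) :
    lieDeriv k F p (PiTensorProduct.tprod k a) =
      (∑ i, c i) • PiTensorProduct.tprod k a := by
  rw [lieDeriv_eq_sum, LinearMap.sum_apply, Finset.sum_smul]
  refine Finset.sum_congr rfl fun m _ => ?_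
  have h1 : applyAt F m a = Function.update a m (c m • a m) := by
    funext j
    rcases eq_or_ne j m with rfl | hj
    · simp [applyAt, h]
    · simp [applyAt, hj, Fin.val_ne_of_ne hj]
  rw [derivAt_tprod, h1, MultilinearMap.map_update_smul, Function.update_eq_self]

variable (A) in
/-- The chain `1 ⊗ ⋯ ⊗ 1`. -/
def unitChain (p : ℕ) : Chains k A p := PiTensorProduct.tprod k fun _ => 1

theorem lieDeriv_unitChain {F : A →ₗ[k] A} (hF : F 1 = 0) (p : ℕ) :
    lieDeriv k F p (unitChain k A p) = 0 := by
  rw [unitChain, lieDeriv_tprod_of_eigen (c := 0) (by simp [hF])]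
  simp

open Polynomial in
theorem aeval_mem_span_unitChain {F : A →ₗ[k] A} (hF : F 1 = 0) (p : ℕ) (q : k[X])
    {x : Chains k A p} (hx : x ∈ Submodule.span k {unitChain k A p}) :
    aeval (lieDeriv k F p) q x ∈ Submodule.span k {unitChain k A p} := by
  obtain ⟨c, rfl⟩ := Submodule.mem_span_singleton.1 hx
  rw [map_smul, Module.End.aeval_apply_of_mem_apply_eq_smul (μ := 0)
    (by rw [lieDeriv_unitChain k hF, zero_smul])]
  exact Submodule.smul_mem _ _ (Submodule.smul_mem _ _ (Submodule.mem_span_singleton_self _))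

end Weight

/-! ### The weight decomposition of chains -/

section Graded

theorem weightMap_one {k : Type*} [CommRing k] {A : Type*} [Ring A] [Algebra k A]
    (𝒜 : ℕ → Submodule k A) [GradedAlgebra 𝒜] : weightMap 𝒜 1 = 0 := by
  rw [weightMap_of_mem 𝒜 SetLike.GradedOne.one_mem, Nat.cast_zero, zero_smul]

variable {k : Type*} [Field k] [CharZero k] {A : Type*} [Ring A] [Algebra k A]
  {𝒜 : ℕ → Submodule k A} [GradedAlgebra 𝒜]

open Polynomial in
/-- A tensor product of homogeneous elements is an eigenvector for its total weight; if that is `0`,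
it is a multiple of `1 ⊗ ⋯ ⊗ 1` by connectedness. -/
theorem exists_aeval_tprod_mem (hA : IsConnectedGraded 𝒜) {p : ℕ} {a : Fin (p + 1) → A}
    {n : Fin (p + 1) → ℕ} (ha : ∀ i, a i ∈ 𝒜 (n i)) :
    ∃ q : k[X], q.coeff 0 ≠ 0 ∧
      aeval (lieDeriv k (weightMap 𝒜) p) q (PiTensorProduct.tprod k a) ∈
        Submodule.span k {unitChain k A p} := by
  have hL := lieDeriv_tprod_of_eigen (F := weightMap 𝒜) fun i => weightMap_of_mem 𝒜 (ha i)
  by_cases hn : ∑ i, n i = 0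
  · refine ⟨1, by simp, ?_⟩
    have hn' : ∀ i, n i = 0 := by simpa using hn
    choose c hc using fun i => hA.surjOn (hn' i ▸ ha i)
    have : a = fun i => c i • (1 : A) := by
      funext i
      rw [← hc i |>.2, Algebra.algebraMap_eq_smul_one]
    rw [this, MultilinearMap.map_smul_univ]
    rw [map_one, Module.End.one_apply]
    exact Submodule.smul_mem _ _ (Submodule.mem_span_singleton_self _)
  · refine ⟨X - C ((∑ i, n i : ℕ) : k), ?_, ?_⟩
    · rw [coeff_sub, coeff_X_zero, coeff_C_zero, zero_sub, neg_ne_zero]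
      exact Nat.cast_ne_zero.2 hn
    · rw [map_sub, aeval_X, aeval_C, LinearMap.sub_apply, Module.algebraMap_end_apply, hL,
        Nat.cast_sum, sub_self]
      exact Submodule.zero_mem _

open Polynomial in
/-- In characteristic `0`, some polynomial in the Lie derivative along the Euler derivation, with
nonzero constant term, takes a given chain to a multiple of `1 ⊗ ⋯ ⊗ 1`. -/
theorem exists_aeval_mem (hA : IsConnectedGraded 𝒜) (p : ℕ) (x : Chains k A p) :
    ∃ q : k[X], q.coeff 0 ≠ 0 ∧
      aeval (lieDeriv k (weightMap 𝒜) p) q x ∈ Submodule.span k {unitChain k A p} := by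
  have hadd : ∀ x y : Chains k A p,
      (∃ q : k[X], q.coeff 0 ≠ 0 ∧
        aeval (lieDeriv k (weightMap 𝒜) p) q x ∈ Submodule.span k {unitChain k A p}) →
      (∃ q : k[X], q.coeff 0 ≠ 0 ∧
        aeval (lieDeriv k (weightMap 𝒜) p) q y ∈ Submodule.span k {unitChain k A p}) →
      ∃ q : k[X], q.coeff 0 ≠ 0 ∧
        aeval (lieDeriv k (weightMap 𝒜) p) q (x + y) ∈ Submodule.span k {unitChain k A p} := by
    rintro x y ⟨q, hq, hx⟩ ⟨r, hr, hy⟩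
    refine ⟨q * r, by rw [mul_coeff_zero]; exact mul_ne_zero hq hr, ?_⟩
    rw [map_add]
    refine Submodule.add_mem _ ?_ ?_
    · rw [mul_comm, map_mul, Module.End.mul_apply]
      exact aeval_mem_span_unitChain k (weightMap_one 𝒜) p r hx
    · rw [map_mul, Module.End.mul_apply]
      exact aeval_mem_span_unitChain k (weightMap_one 𝒜) p q hy
  have hx : x ∈ Submodule.span k (Set.range (PiTensorProduct.tprod k)) := by
    rw [PiTensorProduct.span_tprod_eq_top]; trivial
  induction hx using Submodule.span_induction with
  | mem x hx =>
    classical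
    obtain ⟨a, rfl⟩ := hx
    have h : a = fun i => ∑ n ∈ (DirectSum.decompose 𝒜 (a i)).support,
        (DirectSum.decompose 𝒜 (a i) n : A) :=
      funext fun i => (DirectSum.sum_support_decompose 𝒜 (a i)).symm
    rw [h, MultilinearMap.map_sum_finset]
    exact Finset.sum_induction _ _ hadd ⟨1, by simp, by simp⟩ fun n _ =>
      exists_aeval_tprod_mem hA fun i => (DirectSum.decompose 𝒜 (a i) (n i)).2
  | zero => exact ⟨1, by simp, by simp⟩
  | add x y _ _ hx hy => exact hadd x y hx hy
  | smul c x _ hx =>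
    obtain ⟨q, hq, hx⟩ := hx
    exact ⟨q, hq, by rw [map_smul]; exact Submodule.smul_mem _ _ hx⟩

end Graded

/-! ### An endomorphism invertible up to a subspace -/

section LinearAlgebra
open Polynomial

theorem aeval_apply_mem_of_forall {k V : Type*} [CommRing k] [AddCommGroup V] [Module k V]
    {L : Module.End k V} {I : Submodule k V} (hL : ∀ x ∈ I, L x ∈ I) (q : k[X]) {x : V}
    (hx : x ∈ I) : aeval L q x ∈ I := by
  induction q using Polynomial.induction_on with
  | C c => simpa using I.smul_mem c hx
  | add q r hq hr => simpa using I.add_mem hq hr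
  | monomial n c h =>
    rw [pow_succ', ← mul_assoc, mul_comm (C c), mul_assoc, map_mul, aeval_X, Module.End.mul_apply]
    exact hL _ h

/-- If `L` maps `J` to `I ≤ J`, then `q(L) x` agrees with `q(0) x` modulo `I` for all `x ∈ J`. -/
theorem mem_sup_of_aeval_mem {k V : Type*} [Field k] [AddCommGroup V] [Module k V]
    {L : Module.End k V} {I J W : Submodule k V} (hIJ : I ≤ J) (hL : ∀ x ∈ J, L x ∈ I)
    {q : k[X]} (hq : q.coeff 0 ≠ 0) {x : V} (hx : x ∈ J) (h : aeval L q x ∈ W) :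
    x ∈ I ⊔ W := by
  rw [← Submodule.smul_mem_iff _ hq]
  rw [← divX_mul_X_add q, map_add, map_mul, aeval_X, aeval_C, LinearMap.add_apply,
    Module.End.mul_apply, Module.algebraMap_end_apply] at h
  have h1 : aeval L (divX q) (L x) ∈ I :=
    aeval_apply_mem_of_forall (fun y hy => hL y (hIJ hy)) _ (hL x hx)
  have := Submodule.sub_mem _ (Submodule.mem_sup_right (S := I) h) (Submodule.mem_sup_left h1)
  rwa [add_sub_cancel_left] at this

end LinearAlgebra

/-! ### Chains of units -/

section Units

variable (k : Type*) [CommRing k] (A : Type*) [Ring A] [Algebra k A]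

/-- Insertion of `1` is a contracting homotopy for the chains `1 ⊗ ⋯ ⊗ 1` in positive degree. -/
theorem hochschildB_consOne_unitChain (p : ℕ) :
    hochschildB k A (p + 1) (consOne k (p + 1) (unitChain k A (p + 1))) +
      consOne k p (hochschildB k A p (unitChain k A (p + 1))) = unitChain k A (p + 1) := by
  have h : consOne k p (signedFace k (Fin.last (p + 1)) (unitChain k A (p + 1))) =
      turn k (p + 1) (unitChain k A (p + 1)) := by
    rw [unitChain, signedFace_tprod, turn_tprod, map_smul, consOne, tensorMap_tprod]
    congr 2
    funext l
    refine Fin.cases rfl (fun l => ?_) l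
    simp [face, wrap, rotate]
  have hb : hochschildB k A p = ∑ i : Fin (p + 1), signedFace k i.castSucc +
      signedFace k (Fin.last (p + 1)) := by
    rw [hochschildB_eq_sum, Fin.sum_univ_castSucc]
  rw [hochschildB_consOne, hb, LinearMap.add_apply, map_add, h, LinearMap.sum_apply]
  abel

theorem mem_range_of_mem_span_unitChain (p : ℕ) {x : Chains k A (p + 1)}
    (hx : x ∈ Submodule.span k {unitChain k A (p + 1)}) (h : hochschildB k A p x = 0) :
    x ∈ LinearMap.range (hochschildB k A (p + 1)) := by
  obtain ⟨c, rfl⟩ := Submodule.mem_span_singleton.1 hx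
  refine ⟨consOne k (p + 1) (c • unitChain k A (p + 1)), ?_⟩
  have h1 := congrArg (c • ·) (hochschildB_consOne_unitChain k A p)
  simp only [smul_add, ← map_smul, h] at h1
  rwa [map_zero, add_zero] at h1

theorem unitChain_mem_degenerate (p : ℕ) : unitChain k A (p + 1) ∈ degenerate k A (p + 1) :=
  tprod_mem_degenerate k A _ (Fin.last _) (Fin.last_pos).ne' rfl

theorem connesB_unitChain_mem_degenerate :
    connesB k A 0 (unitChain k A 0) ∈ degenerate k A 1 := by
  rw [unitChain, connesB_tprod]
  exact Submodule.sum_mem _ fun i _ => Submodule.smul_mem _ _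
    (tprod_mem_degenerate k A _ 1 one_ne_zero rfl)

theorem degenerate_zero : degenerate k A 0 = ⊥ := by
  refine Submodule.span_eq_bot.2 ?_
  rintro _ ⟨a, i, hi, -⟩
  exact absurd (Fin.fin_one_eq_zero i) hi

end Units

/-! ### The augmentation -/

section Augmentation

variable {k : Type*} [Field k] {A : Type*} [Ring A] [Algebra k A]
  (𝒜 : ℕ → Submodule k A) [GradedAlgebra 𝒜]

/-- The projection `A → A₀` onto the part of weight `0`, as a map on Hochschild `0`-chains. -/
def augmentation : Chains k A 0 →ₗ[k] A :=
  GradedAlgebra.proj 𝒜 0 ∘ₗ (PiTensorProduct.subsingletonEquiv (0 : Fin 1)).toLinearMap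

theorem augmentation_tprod (a : Fin 1 → A) :
    augmentation 𝒜 (PiTensorProduct.tprod k a) = GradedAlgebra.proj 𝒜 0 (a 0) := by
  simp [augmentation]

theorem proj_zero_mul (a b : A) :
    GradedAlgebra.proj 𝒜 0 (a * b) = GradedAlgebra.proj 𝒜 0 a * GradedAlgebra.proj 𝒜 0 b :=
  map_mul (GradedRing.projZeroRingHom 𝒜) a b

theorem proj_zero_weightMap (a : A) : GradedAlgebra.proj 𝒜 0 (weightMap 𝒜 a) = 0 := by
  induction a using DirectSum.Decomposition.inductionOn 𝒜 with
  | zero => simp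
  | add a b ha hb => rw [map_add, map_add, ha, hb, add_zero]
  | @homogeneous n a =>
    rw [weightMap_of_mem 𝒜 a.2, map_smul]
    rcases eq_or_ne n 0 with rfl | hn
    · simp
    · rw [GradedAlgebra.proj_apply, DirectSum.decompose_of_mem_ne 𝒜 a.2 hn, smul_zero]

theorem augmentation_cap (x : Chains k A 1) :
    augmentation 𝒜 (cap k (weightMap 𝒜) 0 x) = 0 := by
  refine eq_of_tprod (f := augmentation 𝒜 ∘ₗ cap k (weightMap 𝒜) 0) (g := 0) (fun a => ?_) x
  rw [LinearMap.comp_apply, cap_tprod, map_smul, augmentation_tprod, wrap, if_pos rfl,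
    proj_zero_mul, proj_zero_weightMap, zero_mul, smul_zero, LinearMap.zero_apply]

variable {𝒜}

/-- The augmentation kills commutators, as it is multiplicative with image in the central subalgebra
`A₀ = k`. -/
theorem augmentation_hochschildB (hA : IsConnectedGraded 𝒜) (x : Chains k A 1) :
    augmentation 𝒜 (hochschildB k A 0 x) = 0 := by
  refine eq_of_tprod (f := augmentation 𝒜 ∘ₗ hochschildB k A 0) (g := 0) (fun a => ?_) x
  obtain ⟨c, -, hc⟩ := hA.surjOn (SetLike.coe_mem (DirectSum.decompose 𝒜 (a 0) 0))
  have hcomm : GradedAlgebra.proj 𝒜 0 (a 1) * GradedAlgebra.proj 𝒜 0 (a 0) =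
      GradedAlgebra.proj 𝒜 0 (a 0) * GradedAlgebra.proj 𝒜 0 (a 1) := by
    rw [GradedAlgebra.proj_apply 𝒜 0 (a 0), ← hc, Algebra.commutes]
  have h0 : face 0 a 0 = a 0 * a 1 := by simp [face, Fin.contractNth]
  have h1 : face 1 a 0 = a 1 * a 0 := by simp [face, wrap]
  rw [LinearMap.comp_apply, hochschildB_tprod, Fin.sum_univ_two, map_add, map_smul, map_smul,
    augmentation_tprod, augmentation_tprod, h0, h1, proj_zero_mul, proj_zero_mul, hcomm]
  simp

theorem augmentation_unitChain_ne_zero (hA : IsConnectedGraded 𝒜) :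
    augmentation 𝒜 (unitChain k A 0) ≠ 0 := by
  rw [unitChain, augmentation_tprod, GradedAlgebra.proj_apply,
    DirectSum.decompose_of_mem_same 𝒜 SetLike.GradedOne.one_mem]
  intro h
  exact one_ne_zero (hA.injOn (Set.mem_univ (1 : k)) (Set.mem_univ 0) (by simpa using h))

end Augmentation

theorem nonempty_linearEquiv_of_span {k V : Type*} [Field k] [AddCommGroup V] [Module k V]
    {u : V} (hu : u ≠ 0) (h : ∀ x, x ∈ Submodule.span k {u}) : Nonempty (V ≃ₗ[k] k) := by
  refine ⟨(LinearEquiv.ofBijective (LinearMap.toSpanSingleton k V u) ⟨?_, ?_⟩).symm⟩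
  · exact LinearMap.ker_eq_bot.1 (LinearMap.ker_toSpanSingleton k hu)
  · exact fun x => Submodule.mem_span_singleton.1 (h x)

/-! ### Higher Hochschild homology -/

section Higher

variable {k : Type*} [Field k] {A : Type*} [Ring A] [Algebra k A]

/-- The chains of degree `p` of the form `b w + F ⌢ v` with `b v = 0`. For a derivation `F` these
are the Hochschild cycles whose class in `HH_p(A)` is in the image of `[F] ⌢ -`. -/
def higherBoundaries (F : A →ₗ[k] A) (p : ℕ) : Submodule k (Chains k A p) :=
  LinearMap.range (hochschildB k A p) ⊔ (LinearMap.ker (hochschildB k A p)).map (cap k F p)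

/-- The Hochschild cycles of degree `p + 1` whose class in `HH_{p+1}(A)` is killed by `[F] ⌢ -`. -/
def higherCycles (F : A →ₗ[k] A) (p : ℕ) : Submodule k (Chains k A (p + 1)) :=
  LinearMap.ker (hochschildB k A p) ⊓ (LinearMap.range (hochschildB k A p)).comap (cap k F p)

/-- By the homotopy formula, `H(B)` is a homotopy from the Lie derivative to zero for `[F] ⌢ -`. -/
theorem lieDeriv_mem_higherBoundaries {F : A →ₗ[k] A}
    (hF : ∀ a b, F (a * b) = a * F b + F a * b) {p : ℕ} {x : Chains k A (p + 1)}
    (hx : x ∈ higherCycles F p) : lieDeriv k F (p + 1) x ∈ higherBoundaries F (p + 1) := by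
  obtain ⟨hx, y, hy⟩ := hx
  have hx' : hochschildB k A p x = 0 := hx
  rw [← cartan_formula hF, hx', map_zero, add_zero, ← hy]
  refine Submodule.add_mem _ (Submodule.add_mem _ ?_ ?_) ?_
  · refine Submodule.mem_sup_right ⟨_, ?_, rfl⟩
    change hochschildB k A (p + 1) _ = 0
    rw [hochschildB_connesB, hx', map_zero, neg_zero]
  · exact Submodule.mem_sup_left ⟨-connesB k A (p + 1) y, by
      rw [map_neg, hochschildB_connesB, neg_neg]⟩
  · exact Submodule.mem_sup_left ⟨_, rfl⟩

theorem mk_mem_boundaries_capHH {F : A →ₗ[k] A} (hF : ∀ a b, F (a * b) = a * F b + F a * b)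
    {p : ℕ} {z : cycles (hochschildB k A) p} (hz : z.1 ∈ higherBoundaries F p) :
    (Submodule.Quotient.mk z : HH k A p) ∈ boundaries (capHH hF) p := by
  obtain ⟨_, ⟨w, rfl⟩, _, ⟨v, hv, rfl⟩, h⟩ := Submodule.mem_sup.1 hz
  refine ⟨Submodule.Quotient.mk ⟨v, hv⟩, (Submodule.Quotient.eq _).2 ⟨-w, ?_⟩⟩
  change hochschildB k A p (-w) = cap k F p v - z.1
  rw [← h, map_neg]
  abel

theorem mem_higherCycles {F : A →ₗ[k] A} (hF : ∀ a b, F (a * b) = a * F b + F a * b) {p : ℕ}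
    {z : cycles (hochschildB k A) (p + 1)} (h : capHH hF p (Submodule.Quotient.mk z) = 0) :
    z.1 ∈ higherCycles F p :=
  ⟨z.2, (Submodule.Quotient.mk_eq_zero
    ((boundaries (hochschildB k A) p).submoduleOf (cycles (hochschildB k A) p))).1 h⟩

variable [CharZero k]

/-- The image of `F ⌢ -` consists of cycles, as `2 F ⌢ (F ⌢ v)` is a Hochschild boundary if `v` is a
Hochschild cycle. -/
theorem higherBoundaries_le_higherCycles {F : A →ₗ[k] A}
    (hF : ∀ a b, F (a * b) = a * F b + F a * b) (p : ℕ) :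
    higherBoundaries F (p + 1) ≤ higherCycles F p := by
  refine sup_le ?_ ?_
  · rintro _ ⟨w, rfl⟩
    exact ⟨hochschildB_hochschildB k A p w, -cap k F (p + 1) w, by
      rw [map_neg, hochschildB_cap hF, neg_neg]⟩
  · rintro _ ⟨v, hv, rfl⟩
    have hv' : hochschildB k A (p + 1) v = 0 := hv
    refine Submodule.mem_inf.2
      ⟨by rw [LinearMap.mem_ker, hochschildB_cap hF, hv', map_zero, neg_zero], ?_⟩
    rw [Submodule.mem_comap, ← Submodule.smul_mem_iff _ (two_ne_zero (α := k)),
      two_smul_cap_cap hF, hv', map_zero, add_zero]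
    exact LinearMap.mem_range_self _ _

variable {𝒜 : ℕ → Submodule k A} [GradedAlgebra 𝒜]

theorem higherCycles_le_higherBoundaries (hA : IsConnectedGraded 𝒜) (p : ℕ) :
    higherCycles (weightMap 𝒜) p ≤ higherBoundaries (weightMap 𝒜) (p + 1) := by
  intro x hx
  obtain ⟨q, hq, hqx⟩ := exists_aeval_mem hA (p + 1) x
  have hle := higherBoundaries_le_higherCycles (weightMap_mul 𝒜) p
  obtain ⟨y, hy, w, hw, rfl⟩ := Submodule.mem_sup.1 <| mem_sup_of_aeval_mem hle
    (fun x hx => lieDeriv_mem_higherBoundaries (weightMap_mul 𝒜) hx) hq hx hqx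
  -- The error term `w` is a difference of cycles, hence a cycle.
  have hw' := (Submodule.add_mem_iff_right _ (hle hy)).1 hx
  exact Submodule.add_mem _ hy
    (Submodule.mem_sup_left (mem_range_of_mem_span_unitChain k A p hw hw'.1))

theorem mem_higherBoundaries_zero_sup_span (hA : IsConnectedGraded 𝒜) (x : Chains k A 0) :
    x ∈ higherBoundaries (weightMap 𝒜) 0 ⊔ Submodule.span k {unitChain k A 0} := by
  obtain ⟨q, hq, hqx⟩ := exists_aeval_mem hA 0 x
  refine mem_sup_of_aeval_mem le_top (fun x _ => ?_) hq Submodule.mem_top hqx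
  rw [← cartan_formula_zero]
  exact Submodule.mem_sup_right ⟨_, hochschildB_connesB_zero k A x, rfl⟩

theorem subsingleton_higherHH (hA : IsConnectedGraded 𝒜) (p : ℕ) :
    Subsingleton (HigherHH 𝒜 (p + 1)) := by
  refine Submodule.Quotient.subsingleton_iff.2 (eq_top_iff.2 ?_)
  rintro ⟨x, hx⟩ -
  obtain ⟨z, rfl⟩ := Submodule.Quotient.mk_surjective _ x
  exact mk_mem_boundaries_capHH _ (higherCycles_le_higherBoundaries hA p
    (mem_higherCycles (weightMap_mul 𝒜) hx))

theorem nonempty_higherHH_zero_equiv (hA : IsConnectedGraded 𝒜) :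
    Nonempty (HigherHH 𝒜 0 ≃ₗ[k] k) := by
  let u : HH k A 0 := Submodule.Quotient.mk ⟨unitChain k A 0, trivial⟩
  refine nonempty_linearEquiv_of_span (u := Submodule.Quotient.mk ⟨u, trivial⟩) ?_ ?_
  · intro h
    obtain ⟨y, hy⟩ := (Submodule.Quotient.mk_eq_zero _).1 h
    obtain ⟨z, rfl⟩ := Submodule.Quotient.mk_surjective _ y
    obtain ⟨w, hw⟩ := (Submodule.Quotient.eq _).1 hy
    have hw' : hochschildB k A 0 w = cap k (weightMap 𝒜) 0 z.1 - unitChain k A 0 := hw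
    have := congrArg (augmentation 𝒜) hw'
    rw [augmentation_hochschildB hA, map_sub, augmentation_cap, zero_sub] at this
    exact augmentation_unitChain_ne_zero hA (neg_eq_zero.1 this.symm)
  · intro x
    obtain ⟨⟨x, hx⟩, rfl⟩ := Submodule.Quotient.mk_surjective _ x
    obtain ⟨z, rfl⟩ := Submodule.Quotient.mk_surjective _ x
    obtain ⟨y, hy, w, hw, h⟩ := Submodule.mem_sup.1 (mem_higherBoundaries_zero_sup_span hA z.1)
    obtain ⟨c, rfl⟩ := Submodule.mem_span_singleton.1 hw
    refine Submodule.mem_span_singleton.2 ⟨c, ((Submodule.Quotient.eq _).2 ?_).symm⟩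
    refine mk_mem_boundaries_capHH (weightMap_mul 𝒜)
      (z := z - c • ⟨unitChain k A 0, trivial⟩) ?_
    change z.1 - c • unitChain k A 0 ∈ _
    rwa [← h, add_sub_cancel_right]

end Higher

/-! ### De Rham cohomology -/

section DeRham

variable {k : Type*} [Field k] {A : Type*} [Ring A] [Algebra k A]

variable (k A) in
/-- The chains representing cycles of the normalized complex. -/
def normalizedCycles (p : ℕ) : Submodule k (Chains k A p) :=
  (cycles (normalizedB k A) p).comap (degenerate k A p).mkQ

variable (k A) in
/-- The chains representing boundaries of the normalized complex. -/
def normalizedBoundaries (p : ℕ) : Submodule k (Chains k A p) :=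
  LinearMap.range (hochschildB k A p) ⊔ degenerate k A p

theorem mem_normalizedCycles_succ {p : ℕ} {x : Chains k A (p + 1)} :
    x ∈ normalizedCycles k A (p + 1) ↔ hochschildB k A p x ∈ degenerate k A p :=
  Submodule.Quotient.mk_eq_zero _

theorem mk_mem_boundaries_normalizedB {p : ℕ} {x : Chains k A p} :
    (Submodule.Quotient.mk x : NormalizedChains k A p) ∈ boundaries (normalizedB k A) p ↔
      x ∈ normalizedBoundaries k A p := by
  constructor
  · rintro ⟨y, hy⟩
    obtain ⟨y, rfl⟩ := Submodule.Quotient.mk_surjective _ y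
    have := (Submodule.Quotient.eq _).1 hy
    rw [← sub_sub_cancel (hochschildB k A p y) x]
    exact Submodule.sub_mem _ (Submodule.mem_sup_left ⟨y, rfl⟩) (Submodule.mem_sup_right this)
  · intro h
    obtain ⟨_, ⟨y, rfl⟩, d, hd, rfl⟩ := Submodule.mem_sup.1 h
    refine ⟨Submodule.Quotient.mk y, (Submodule.Quotient.eq _).2 ?_⟩
    rw [sub_add_cancel_left]
    exact Submodule.neg_mem _ hd

variable (k A) in
/-- The chains representing a class in normalized Hochschild homology that is killed by `H(B)`. -/
def deRhamCycles (p : ℕ) : Submodule k (Chains k A p) :=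
  normalizedCycles k A p ⊓ (normalizedBoundaries k A (p + 1)).comap (connesB k A p)

variable (k A) in
/-- The chains representing a class in normalized Hochschild homology that is in the image of
`H(B)`, which in degree `0` means the zero class. -/
def deRhamBoundaries : ∀ p, Submodule k (Chains k A p)
  | 0 => normalizedBoundaries k A 0
  | p + 1 => normalizedBoundaries k A (p + 1) ⊔ (normalizedCycles k A p).map (connesB k A p)

theorem mem_deRhamCycles {p : ℕ} {z : Chains k A p} (hz : z ∈ normalizedCycles k A p)
    (h : deRhamD k A p (Submodule.Quotient.mk ⟨Submodule.Quotient.mk z, hz⟩) = 0) :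
    z ∈ deRhamCycles k A p :=
  ⟨hz, mk_mem_boundaries_normalizedB.1 ((Submodule.Quotient.mk_eq_zero
    ((boundaries (normalizedB k A) (p + 1)).submoduleOf (cycles (normalizedB k A) (p + 1)))).1 h)⟩

theorem normalizedBoundaries_le_deRhamCycles (p : ℕ) :
    normalizedBoundaries k A p ≤ deRhamCycles k A p := by
  refine sup_le ?_ ?_
  · rintro _ ⟨w, rfl⟩
    refine ⟨?_, Submodule.mem_sup_left ⟨-connesB k A (p + 1) w, by
      rw [map_neg, hochschildB_connesB, neg_neg]⟩⟩
    cases p with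
    | zero => trivial
    | succ p =>
      refine mem_normalizedCycles_succ.2 ?_
      rw [hochschildB_hochschildB]
      exact Submodule.zero_mem _
  · intro x hx
    refine ⟨?_, Submodule.mem_sup_right (degenerate_le_comap_connesB k A p hx)⟩
    cases p with
    | zero => trivial
    | succ p => exact mem_normalizedCycles_succ.2 (degenerate_le_comap_hochschildB k A p hx)

theorem deRhamBoundaries_le_deRhamCycles (p : ℕ) :
    deRhamBoundaries k A p ≤ deRhamCycles k A p := by
  cases p with
  | zero => exact normalizedBoundaries_le_deRhamCycles 0
  | succ p =>
    refine sup_le (normalizedBoundaries_le_deRhamCycles (p + 1)) ?_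
    rintro _ ⟨v, hv, rfl⟩
    refine ⟨mem_normalizedCycles_succ.2 ?_, Submodule.mem_sup_right (connesB_connesB_mem k A p v)⟩
    cases p with
    | zero =>
      rw [hochschildB_connesB_zero]
      exact Submodule.zero_mem _
    | succ p =>
      rw [hochschildB_connesB]
      exact Submodule.neg_mem _
        (degenerate_le_comap_connesB k A p (mem_normalizedCycles_succ.1 hv))

theorem cap_mem_normalizedBoundaries {F : A →ₗ[k] A}
    (hF : ∀ a b, F (a * b) = a * F b + F a * b) (hF1 : F 1 = 0) {p : ℕ} {x : Chains k A (p + 1)}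
    (hx : x ∈ normalizedBoundaries k A (p + 1)) : cap k F p x ∈ normalizedBoundaries k A p := by
  obtain ⟨_, ⟨w, rfl⟩, d, hd, rfl⟩ := Submodule.mem_sup.1 hx
  rw [map_add]
  refine Submodule.add_mem _ (Submodule.mem_sup_left ⟨-cap k F (p + 1) w, ?_⟩)
    (Submodule.mem_sup_right (degenerate_le_comap_cap k hF1 p hd))
  rw [map_neg, hochschildB_cap hF, neg_neg]

theorem cap_mem_normalizedCycles {F : A →ₗ[k] A}
    (hF : ∀ a b, F (a * b) = a * F b + F a * b) (hF1 : F 1 = 0) {p : ℕ} {x : Chains k A (p + 1)}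
    (hx : x ∈ normalizedCycles k A (p + 1)) : cap k F p x ∈ normalizedCycles k A p := by
  cases p with
  | zero => trivial
  | succ p =>
    refine mem_normalizedCycles_succ.2 ?_
    rw [hochschildB_cap hF]
    exact Submodule.neg_mem _ (degenerate_le_comap_cap k hF1 p (mem_normalizedCycles_succ.1 hx))

/-- By the homotopy formula, `[F] ⌢ -` is a homotopy from the Lie derivative to zero for `H(B)`. -/
theorem lieDeriv_mem_deRhamBoundaries {F : A →ₗ[k] A}
    (hF : ∀ a b, F (a * b) = a * F b + F a * b) (hF1 : F 1 = 0) {p : ℕ} {x : Chains k A p}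
    (hx : x ∈ deRhamCycles k A p) : lieDeriv k F p x ∈ deRhamBoundaries k A p := by
  obtain ⟨hx, hBx⟩ := hx
  have h := cap_mem_normalizedBoundaries hF hF1 hBx
  cases p with
  | zero => rwa [← cartan_formula_zero]
  | succ p =>
    rw [← cartan_formula hF]
    refine Submodule.add_mem _ (Submodule.add_mem _ (Submodule.mem_sup_left h)
      (Submodule.mem_sup_right ⟨_, cap_mem_normalizedCycles hF hF1 hx, rfl⟩))
      (Submodule.mem_sup_left (Submodule.add_mem _ (Submodule.mem_sup_left ⟨_, rfl⟩)
        (Submodule.mem_sup_right ?_)))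
    exact degenerate_le_comap_cartanE k hF1 p (mem_normalizedCycles_succ.1 hx)

variable [CharZero k] {𝒜 : ℕ → Submodule k A} [GradedAlgebra 𝒜]

theorem mem_deRhamBoundaries_sup_span (hA : IsConnectedGraded 𝒜) {p : ℕ} {x : Chains k A p}
    (hx : x ∈ deRhamCycles k A p) :
    x ∈ deRhamBoundaries k A p ⊔ Submodule.span k {unitChain k A p} := by
  obtain ⟨q, hq, hqx⟩ := exists_aeval_mem hA p x
  exact mem_sup_of_aeval_mem (deRhamBoundaries_le_deRhamCycles p)
    (fun x hx => lieDeriv_mem_deRhamBoundaries (weightMap_mul 𝒜) (weightMap_one 𝒜) hx) hq hx hqx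

theorem subsingleton_deRhamCohomology (hA : IsConnectedGraded 𝒜) (p : ℕ) :
    Subsingleton (DeRhamCohomology k A (p + 1)) := by
  refine Submodule.Quotient.subsingleton_iff.2 (eq_top_iff.2 ?_)
  rintro ⟨x, hx⟩ -
  obtain ⟨⟨x, hx'⟩, rfl⟩ := Submodule.Quotient.mk_surjective _ x
  obtain ⟨z, rfl⟩ := Submodule.Quotient.mk_surjective _ x
  have hz : z ∈ deRhamCycles k A (p + 1) := mem_deRhamCycles hx' hx
  have hle : deRhamBoundaries k A (p + 1) ⊔ Submodule.span k {unitChain k A (p + 1)} ≤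
      deRhamBoundaries k A (p + 1) :=
    sup_le le_rfl (Submodule.span_le.2 (Set.singleton_subset_iff.2
      (Submodule.mem_sup_left (Submodule.mem_sup_right (unitChain_mem_degenerate k A p)))))
  obtain ⟨y, hy, _, ⟨v, hv, rfl⟩, h⟩ :=
    Submodule.mem_sup.1 (hle (mem_deRhamBoundaries_sup_span hA hz))
  refine ⟨Submodule.Quotient.mk ⟨Submodule.Quotient.mk v, hv⟩, (Submodule.Quotient.eq _).2 ?_⟩
  change (Submodule.Quotient.mk (connesB k A p v - z) : NormalizedChains k A (p + 1)) ∈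
    boundaries (normalizedB k A) (p + 1)
  rw [mk_mem_boundaries_normalizedB, ← h, sub_add_cancel_right]
  exact Submodule.neg_mem _ hy

theorem nonempty_deRhamCohomology_zero_equiv (hA : IsConnectedGraded 𝒜) :
    Nonempty (DeRhamCohomology k A 0 ≃ₗ[k] k) := by
  let u : NormalizedHH k A 0 :=
    Submodule.Quotient.mk ⟨Submodule.Quotient.mk (unitChain k A 0), trivial⟩
  have hu : deRhamD k A 0 u = 0 := (Submodule.Quotient.mk_eq_zero _).2
    (mk_mem_boundaries_normalizedB.2
      (Submodule.mem_sup_right (connesB_unitChain_mem_degenerate k A)))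
  refine nonempty_linearEquiv_of_span (u := Submodule.Quotient.mk ⟨u, hu⟩) ?_ ?_
  · intro h
    have h1 : u = 0 := (Submodule.Quotient.mk_eq_zero _).1 h
    have h2 := mk_mem_boundaries_normalizedB.1 ((Submodule.Quotient.mk_eq_zero _).1 h1)
    rw [normalizedBoundaries, degenerate_zero, sup_bot_eq] at h2
    obtain ⟨w, hw⟩ := h2
    exact augmentation_unitChain_ne_zero hA (hw ▸ augmentation_hochschildB hA w)
  · intro x
    obtain ⟨⟨x, hx⟩, rfl⟩ := Submodule.Quotient.mk_surjective _ x
    obtain ⟨⟨x, hx'⟩, rfl⟩ := Submodule.Quotient.mk_surjective _ x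
    obtain ⟨z, rfl⟩ := Submodule.Quotient.mk_surjective _ x
    have hz : z ∈ deRhamCycles k A 0 :=
      mem_deRhamCycles hx' hx
    obtain ⟨y, hy, w, hw, h⟩ := Submodule.mem_sup.1 (mem_deRhamBoundaries_sup_span hA hz)
    obtain ⟨c, rfl⟩ := Submodule.mem_span_singleton.1 hw
    refine Submodule.mem_span_singleton.2 ⟨c, ((Submodule.Quotient.eq _).2 ?_).symm⟩
    refine (Submodule.Quotient.mk_eq_zero _).2 ?_
    change (Submodule.Quotient.mk (z - c • unitChain k A 0) : NormalizedChains k A 0) ∈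
      boundaries (normalizedB k A) 0
    rw [mk_mem_boundaries_normalizedB, ← h, add_sub_cancel_right]
    exact hy

end DeRham

end GradedHochschild

end

theorem mainTheorem5 {k : Type*} [Field k] [CharZero k] {A : Type*} [Ring A] [Algebra k A]
    (𝒜 : ℕ → Submodule k A) [GradedAlgebra 𝒜] (hA : GradedHochschild.IsConnectedGraded 𝒜) :
    Nonempty (GradedHochschild.DeRhamCohomology k A 0 ≃ₗ[k] k) ∧
    Nonempty (GradedHochschild.HigherHH 𝒜 0 ≃ₗ[k] k) ∧
    ∀ p : ℕ, 0 < p →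
      Subsingleton (GradedHochschild.DeRhamCohomology k A p) ∧
      Subsingleton (GradedHochschild.HigherHH 𝒜 p) := by
  refine ⟨GradedHochschild.nonempty_deRhamCohomology_zero_equiv hA,
    GradedHochschild.nonempty_higherHH_zero_equiv hA, fun p hp => ?_⟩
  obtain ⟨p, rfl⟩ := Nat.exists_eq_succ_of_ne_zero hp.ne'
  exact ⟨GradedHochschild.subsingleton_deRhamCohomology hA p,
    GradedHochschild.subsingleton_higherHH hA p⟩
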